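/- All manifolds are Hausdorff and smooth ($C^\infty$). A manifold with boundary is locally modelled on $\mathbb{R}^{n-1}\times[0,\infty)$; a closed manifold is a compact manifold without boundary. Two closed $n$-manifolds $M,N$ are cobordant if there is a compact $(n+1)$-manifold with boundary $W$ whose boundary $\partial W$ is the disjoint union $M\sqcup N$, i.e. there is a smooth embedding $M\sqcup N\to W$ with image $\partial W$. The following hold. (1) Every compact one-dimensional manifold with boundary has finitely many boundary points, and their number is even. (2) Every connected compact one-dimensional manifold with boundary is diffeomorphic to the circle $S^1$ or to the interval $[0,1]$. (3) For $m\in\mathbb{N}$, there is a compact one-dimensional manifold with boundary that has exactly $m$ boundary points if and only if $m$ is even. (4) Every closed zero-dimensional manifold $M$ is finite; $M$ is cobordant to the empty manifold if and only if its number of points is even, and $M$ is cobordant to the one-point manifold if and only if its number of points is odd. (5) Cobordism is an equivalence relation on closed zero-dimensional manifolds; two of them are cobordant if and only if their numbers of points have the same parity, and there are exactly two cobordism classes. -/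

import Mathlib

/-!
Embed the compact manifold `M` in a Euclidean space and parametrize it locally by arc length. At a
boundary point the parametrization `γ` is extended by reflection, `γ (c + s) = γ (c - s)`, so that
a unit-speed curve folds back instead of ending; by compactness it then extends by a uniform amount
at every time, hence to all of `ℝ`. Two unit-speed curves through the same point agree up to an
isometry of `ℝ`, so a connected `M` is the quotient of `ℝ` by the isometries `φ` with
`γ ∘ φ = γ`. Local injectivity makes the translations among them discrete, and compactness makes
them nontrivial. If there are only translations, then `M` is a circle; if there is a reflection,
then `M` is half a period, a compact interval. Every component therefore has `0` or `2` boundary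
points, and conversely an even number of points bounds a disjoint union of intervals.
-/

open scoped Manifold ContDiff

universe u

/-- A closed smooth `n`-manifold: a compact Hausdorff smooth manifold modelled on `ℝⁿ` (hence
without boundary). Second countability follows from compactness. -/
structure ClosedManifold (n : ℕ) : Type (u + 1) where
  carrier : Type u
  [topologicalSpace : TopologicalSpace carrier]
  [t2Space : T2Space carrier]
  [compactSpace : CompactSpace carrier]
  [chartedSpace : ChartedSpace (EuclideanSpace ℝ (Fin n)) carrier]
  [isManifold : IsManifold (𝓡 n) ∞ carrier]

namespace ClosedManifold

attribute [instance] topologicalSpace t2Space compactSpace chartedSpace isManifold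

/-- The empty manifold, in dimension `n`. -/
noncomputable def empty (n : ℕ) : ClosedManifold.{u} n :=
  letI : ChartedSpace (EuclideanSpace ℝ (Fin n)) PEmpty.{u + 1} := ChartedSpace.empty _ _
  { carrier := PEmpty.{u + 1} }

/-- The one-point manifold. -/
noncomputable def point : ClosedManifold.{u} 0 :=
  letI : ChartedSpace (EuclideanSpace ℝ (Fin 0)) PUnit.{u + 1} := ChartedSpace.ofDiscreteTopology
  { carrier := PUnit.{u + 1}
    isManifold := IsManifold.of_discreteTopology _ }

/-- Two closed `n`-manifolds `M`, `N` are cobordant if there is a compact smooth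
`(n + 1)`-manifold with boundary `W` whose boundary is the disjoint union of `M` and `N`, i.e.
there is a smooth embedding of `M ⊔ N` into `W` with image `∂W`. -/
def Cobordant {n : ℕ} (M N : ClosedManifold.{u} n) : Prop :=
  ∃ (W : Type u) (_ : TopologicalSpace W) (_ : T2Space W) (_ : CompactSpace W)
    (_ : ChartedSpace (EuclideanHalfSpace (n + 1)) W) (_ : IsManifold (𝓡∂ (n + 1)) ∞ W)
    (f : M.carrier ⊕ N.carrier → W),
    Manifold.IsSmoothEmbedding (𝓡 n) (𝓡∂ (n + 1)) ∞ f ∧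
      Set.range f = (𝓡∂ (n + 1)).boundary W

/-- The set of cobordism classes of closed `n`-manifolds. -/
def CobordismClass (n : ℕ) : Type (u + 1) :=
  Quot (Cobordant : ClosedManifold.{u} n → ClosedManifold.{u} n → Prop)

end ClosedManifold

section

open Set Filter Topology

/-! ### Isometries and arc length on the line -/

theorem realIsometryEquiv_eq_add_or_sub (φ : ℝ ≃ᵢ ℝ) :
    (∀ t, φ t = φ 0 + t) ∨ ∀ t, φ t = φ 0 - t := by
  have hdist : ∀ s t, φ s - φ t = s - t ∨ φ s - φ t = -(s - t) := fun s t =>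
    abs_eq_abs.1 (φ.dist_eq s t)
  rcases hdist 1 0 with h1 | h1
  · refine .inl fun t => ?_
    rcases hdist t 0 with h | h <;> rcases hdist t 1 with h' | h' <;> linarith
  · refine .inr fun t => ?_
    rcases hdist t 0 with h | h <;> rcases hdist t 1 with h' | h' <;> linarith

theorem contDiff_realIsometryEquiv (φ : ℝ ≃ᵢ ℝ) : ContDiff ℝ ∞ φ := by
  rcases realIsometryEquiv_eq_add_or_sub φ with h | h
  · exact funext h ▸ contDiff_const.add contDiff_id
  · exact funext h ▸ contDiff_const.sub contDiff_id

theorem eq_or_eq_reflection_of_realIsometryEquiv_apply_eq_self {φ : ℝ ≃ᵢ ℝ} {a : ℝ}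
    (ha : φ a = a) : (∀ t, φ t = t) ∨ ∀ t, φ t = 2 * a - t := by
  rcases realIsometryEquiv_eq_add_or_sub φ with h | h
  · exact .inl fun t => by linarith [h a, h t]
  · exact .inr fun t => by linarith [h a, h t]

theorem exists_isometryEquiv_abs_eq (x : ℝ) :
    ∃ ρ : ℝ ≃ᵢ ℝ, (∀ t, |ρ t| = |t|) ∧ ρ |x| = x ∧ (x ≠ 0 → ∀ᶠ t in 𝓝 x, ρ |t| = t) := by
  rcases le_total 0 x with h | h
  · refine ⟨.refl ℝ, fun t => rfl, abs_of_nonneg h, fun hx => ?_⟩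
    filter_upwards [lt_mem_nhds (h.lt_of_ne' hx)] with t ht using abs_of_pos ht
  · refine ⟨.neg ℝ, abs_neg, by simp [abs_of_nonpos h], fun hx => ?_⟩
    filter_upwards [gt_mem_nhds (h.lt_of_ne hx)] with t ht
    simp [abs_of_neg ht]

theorem exists_realIsometryEquiv_eventuallyEq {ψ d : ℝ → ℝ} {K : Set ℝ} {s : ℝ}
    (hK : Convex ℝ K) (hs : s ∈ K) (hd : ContinuousWithinAt d K s)
    (hψ : ∀ᶠ t in 𝓝[K] s, HasDerivWithinAt ψ (d t) K t ∧ |d t| = 1) :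
    ∃ φ : ℝ ≃ᵢ ℝ, φ s = ψ s ∧ ∀ᶠ t in 𝓝[K] s, ψ t = φ t := by
  have hds : |d s| = 1 := (hψ.self_of_nhdsWithin hs).2
  have hconst : ∀ᶠ t in 𝓝[K] s, HasDerivWithinAt ψ (d s) K t := by
    filter_upwards [hψ, hd.eventually (Metric.ball_mem_nhds (d s) one_pos)] with t ⟨ht, ht1⟩ hdt
    suffices h : d t = d s from h ▸ ht
    rw [Real.dist_eq, abs_lt] at hdt
    rcases eq_or_eq_neg_of_abs_eq ht1 with h | h <;>
      rcases eq_or_eq_neg_of_abs_eq hds with h' | h' <;> linarith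
  have haffine : ∀ᶠ t in 𝓝[K] s, ψ t = ψ s + d s * (t - s) := by
    obtain ⟨r, hr, hball⟩ := Metric.mem_nhdsWithin_iff.1 hconst
    filter_upwards [mem_nhdsWithin_of_mem_nhds (Metric.ball_mem_nhds s hr),
      self_mem_nhdsWithin] with t htr htK
    have hderiv : ∀ τ ∈ Metric.ball s r ∩ K,
        HasDerivWithinAt (fun τ => ψ τ - d s * τ) 0 (Metric.ball s r ∩ K) τ := fun τ hτ =>
      (((hball hτ).mono inter_subset_right).fun_sub
        ((hasDerivWithinAt_id τ _).const_mul (d s))).congr_deriv (by simp)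
    have h := ((convex_ball s r).inter hK).norm_image_sub_le_of_norm_hasDerivWithin_le (C := 0)
      hderiv (by simp) ⟨Metric.mem_ball_self hr, hs⟩ ⟨htr, htK⟩
    have h0 : ψ t - d s * t - (ψ s - d s * s) = 0 := by simpa using h
    linarith
  rcases eq_or_eq_neg_of_abs_eq hds with h | h
  · refine ⟨(IsometryEquiv.subRight s).trans (IsometryEquiv.addLeft (ψ s)), by simp, ?_⟩
    filter_upwards [haffine] with t ht
    simp [ht, h]
  · refine ⟨(IsometryEquiv.subLeft s).trans (IsometryEquiv.addLeft (ψ s)), by simp, ?_⟩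
    filter_upwards [haffine] with t ht
    simp [ht, h]

theorem contDiffOn_infty_of_hasDerivWithinAt_comp {E : Type*} [NormedAddCommGroup E]
    [NormedSpace ℝ E] {f : E → E} {T : ℝ → E} {A : Set ℝ} {J : Set E} (hA : UniqueDiffOn ℝ A)
    (hTA : MapsTo T A J) (hf : ContDiffOn ℝ ∞ f J)
    (hT : ∀ t ∈ A, HasDerivWithinAt T (f (T t)) A t) : ContDiffOn ℝ ∞ T A := by
  refine contDiffOn_infty.2 fun n => ?_
  induction n with
  | zero => exact contDiffOn_zero.2 fun t ht => (hT t ht).continuousWithinAt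
  | succ n ih =>
    rw [Nat.cast_succ, contDiffOn_succ_iff_derivWithin hA]
    refine ⟨fun t ht => (hT t ht).differentiableWithinAt, by simp, ?_⟩
    have hcomp : ContDiffOn ℝ n (f ∘ T) A := (hf.of_le (by exact_mod_cast le_top)).comp ih hTA
    exact hcomp.congr fun t ht => (hT t ht).derivWithin (hA t ht)

theorem exists_continuousMap_eqOn_and_forall_le {X : Type*} [TopologicalSpace X] [NormalSpace X]
    [T2Space X] {K : Set X} (hK : IsCompact K) {f : X → ℝ} (hf : ContinuousOn f K)
    (hpos : ∀ x ∈ K, 0 < f x) :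
    ∃ g : C(X, ℝ), EqOn g f K ∧ ∃ m > 0, ∀ x, m ≤ g x := by
  obtain ⟨m, hm, hmf⟩ : ∃ m > 0, ∀ x ∈ K, m ≤ f x := hK.exists_forall_le' hf hpos
  obtain ⟨g, hg, hgf⟩ := ContinuousMap.exists_restrict_eq_forall_mem_of_closed
    ⟨K.domRestrict f, hf.domRestrict⟩ (t := Ici m) (fun x => hmf x x.2) nonempty_Ici hK.isClosed
  exact ⟨g, fun x hx => DFunLike.congr_fun hgf ⟨x, hx⟩, m, hm, hg⟩

theorem exists_orderIso_hasDerivAt {v : ℝ → ℝ} {m : ℝ} (hv : Continuous v) (hm : 0 < m)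
    (hmv : ∀ t, m ≤ v t) : ∃ S : ℝ ≃o ℝ, S 0 = 0 ∧ ∀ t, HasDerivAt S (v t) t := by
  set S : ℝ → ℝ := fun t => ∫ τ in (0 : ℝ)..t, v τ
  have hS0 : S 0 = 0 := intervalIntegral.integral_same
  have hd : ∀ t, HasDerivAt S (v t) t := fun t => hv.integral_hasStrictDerivAt 0 t |>.hasDerivAt
  have hdiff : Differentiable ℝ S := fun t => (hd t).differentiableAt
  have hmono : StrictMono S := strictMono_of_deriv_pos fun t => by
    rw [(hd t).deriv]
    exact hm.trans_le (hmv t)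
  have hle : ∀ ⦃s t⦄, s ≤ t → m * (t - s) ≤ S t - S s := by
    refine mul_sub_le_image_sub_of_le_deriv hdiff fun t => ?_
    rw [(hd t).deriv]
    exact hmv t
  have htop : Tendsto S atTop atTop :=
    tendsto_atTop_mono' _ ((eventually_ge_atTop 0).mono fun t ht => by simpa [hS0] using hle ht)
      (tendsto_id.const_mul_atTop hm)
  have hbot : Tendsto S atBot atBot :=
    tendsto_atBot_mono' _ ((eventually_le_atBot 0).mono fun t ht => by simpa [hS0] using hle ht)
      (tendsto_id.const_mul_atBot hm)
  exact ⟨hmono.orderIsoOfSurjective S (hdiff.continuous.surjective htop hbot), hS0, hd⟩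

theorem exists_orderIso_contDiffOn {w : ℝ → ℝ} {J K : Set ℝ} (hK : IsCompact K) (hJK : J ⊆ K)
    (hJ : UniqueDiffOn ℝ J) (hw : ContDiffOn ℝ ∞ w K) (hpos : ∀ t ∈ K, 0 < w t) :
    ∃ S : ℝ ≃o ℝ, S 0 = 0 ∧ ContDiffOn ℝ ∞ S J ∧ ContDiffOn ℝ ∞ S.symm (S.symm ⁻¹' J) ∧
      ∀ t, S.symm t ∈ J → HasDerivAt S.symm (w (S.symm t))⁻¹ t := by
  -- Off `K`, `w` is replaced by a function bounded below, so that its primitive maps onto `ℝ`.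
  obtain ⟨v, hvw, m, hm, hmv⟩ := exists_continuousMap_eqOn_and_forall_le hK hw.continuousOn hpos
  obtain ⟨S, hS0, hS⟩ := exists_orderIso_hasDerivAt v.continuous hm hmv
  have hSJ : ∀ t ∈ J, HasDerivAt S (w t) t := fun t ht => hvw (hJK ht) ▸ hS t
  have hTJ : ∀ t, S.symm t ∈ J → HasDerivAt S.symm (w (S.symm t))⁻¹ t := fun t ht =>
    (hSJ _ ht).of_local_left_inverse S.symm.continuous.continuousAt (hpos _ (hJK ht)).ne'
      (.of_forall S.apply_symm_apply)
  refine ⟨S, hS0, ?_, ?_, hTJ⟩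
  · rw [contDiffOn_infty_iff_derivWithin hJ]
    exact ⟨fun t ht => (hSJ t ht).differentiableAt.differentiableWithinAt,
      (hw.mono hJK).congr fun t ht => (hSJ t ht).hasDerivWithinAt.derivWithin (hJ t ht)⟩
  · have huniq : UniqueDiffOn ℝ (S.symm ⁻¹' J) := by
      rw [← OrderIso.image_eq_preimage_symm]
      rintro _ ⟨t, ht, rfl⟩
      refine (hSJ t ht).hasDerivWithinAt.hasFDerivWithinAt.uniqueDiffWithinAt (hJ t ht) ?_
      refine Function.Surjective.denseRange fun y => ⟨y / w t, ?_⟩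
      simp [(hpos t (hJK ht)).ne']
    exact contDiffOn_infty_of_hasDerivWithinAt_comp huniq (fun t ht => ht)
      ((hw.mono hJK).inv fun t ht => (hpos t (hJK ht)).ne') fun t ht => (hTJ t ht).hasDerivWithinAt

/-! ### Half-line charts -/

theorem tendsto_abs_nhdsWithin_Ici (t : ℝ) : Tendsto (|·|) (𝓝 t) (𝓝[Ici 0] |t|) :=
  tendsto_nhdsWithin_iff.2 ⟨continuous_abs.continuousAt, .of_forall abs_nonneg⟩

/-- The identification of `EuclideanSpace ℝ (Fin 1)` with `ℝ`. -/
noncomputable def euclideanLine : EuclideanSpace ℝ (Fin 1) ≃L[ℝ] ℝ :=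
  (EuclideanSpace.equiv (Fin 1) ℝ).trans (ContinuousLinearEquiv.funUnique (Fin 1) ℝ ℝ)

/-- A smooth coordinate on an open subset of a one-dimensional manifold with boundary, with values
in a relatively open subset of the half-line `[0, ∞)`. Relative openness of the target is stated
through the neighbourhood filters `𝓝[Ici 0] t`. -/
structure HalfLineChart (M : Type*) [TopologicalSpace M] [ChartedSpace (EuclideanHalfSpace 1) M]
    extends PartialEquiv M ℝ where
  open_source : IsOpen source
  target_nonneg : ∀ t ∈ target, 0 ≤ t
  target_mem_nhdsWithin : ∀ t ∈ target, target ∈ 𝓝[Ici 0] t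
  contMDiffOn_toFun : ContMDiffOn (𝓡∂ 1) 𝓘(ℝ) ∞ toFun source
  contMDiffOn_symm : ContMDiffOn 𝓘(ℝ) (𝓡∂ 1) ∞ toPartialEquiv.symm target

namespace HalfLineChart

variable {M : Type*} [TopologicalSpace M] [ChartedSpace (EuclideanHalfSpace 1) M]

instance : CoeFun (HalfLineChart M) fun _ => M → ℝ := ⟨fun C => C.toPartialEquiv⟩

variable (C : HalfLineChart M) {t : ℝ}

theorem nhdsWithin_target (ht : t ∈ C.target) : 𝓝[C.target] t = 𝓝[Ici 0] t :=
  (nhdsWithin_mono t C.target_nonneg).antisymm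
    (nhdsWithin_le_of_mem (C.target_mem_nhdsWithin t ht))

theorem uniqueDiffOn_target : UniqueDiffOn ℝ C.target := fun t ht =>
  (uniqueDiffOn_Ici 0 t (C.target_nonneg t ht)).mono_nhds (C.nhdsWithin_target ht).ge

theorem tendsto_nhdsWithin_Ici {x : M} (hx : x ∈ C.source) : Tendsto C (𝓝 x) (𝓝[Ici 0] C x) :=
  tendsto_nhdsWithin_iff.2
    ⟨(C.contMDiffOn_toFun.continuousOn.continuousAt (C.open_source.mem_nhds hx)),
      (C.open_source.eventually_mem hx).mono fun _ hy => C.target_nonneg _ (C.map_source hy)⟩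

theorem tendsto_symm (ht : t ∈ C.target) : Tendsto C.symm (𝓝[Ici 0] t) (𝓝 (C.symm t)) :=
  C.nhdsWithin_target ht ▸ C.contMDiffOn_symm.continuousOn t ht

theorem eventually_abs_mem_target (ht : |t| ∈ C.target) : ∀ᶠ s in 𝓝 t, |s| ∈ C.target :=
  (tendsto_abs_nhdsWithin_Ici t).eventually (C.target_mem_nhdsWithin _ ht)

theorem continuousAt_symm_abs (ht : |t| ∈ C.target) : ContinuousAt (fun s => C.symm |s|) t :=
  (C.tendsto_symm ht).comp (tendsto_abs_nhdsWithin_Ici t)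

theorem image_symm_abs_mem_nhds (ht : |t| ∈ C.target) {V : Set ℝ} (hV : V ∈ 𝓝 t) :
    (fun s => C.symm |s|) '' V ∈ 𝓝 (C.symm |t|) := by
  have hx : C.symm |t| ∈ C.source := C.map_target ht
  obtain ⟨ρ, hρ, hρt, -⟩ := exists_isometryEquiv_abs_eq t
  have htend : Tendsto (ρ ∘ C) (𝓝 (C.symm |t|)) (𝓝 t) := by
    have h := (C.tendsto_nhdsWithin_Ici hx).mono_right nhdsWithin_le_nhds
    rw [C.right_inv ht] at h
    simpa only [hρt] using (ρ.continuous.tendsto |t|).comp h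
  filter_upwards [htend hV, C.open_source.mem_nhds hx] with y hyV hy
  refine ⟨ρ (C y), hyV, ?_⟩
  calc C.symm |ρ (C y)| = C.symm (C y) := by
        rw [hρ, abs_of_nonneg (C.target_nonneg _ (C.map_source hy))]
    _ = y := C.left_inv hy

/-- The preferred chart at `p`, read as a half-line chart. -/
noncomputable def ofChartAt [IsManifold (𝓡∂ 1) ∞ M] (p : M) : HalfLineChart M where
  toPartialEquiv := (extChartAt (𝓡∂ 1) p).transEquiv euclideanLine.toEquiv
  open_source := isOpen_extChartAt_source p
  target_nonneg t ht := by
    have h := extChartAt_target_subset_range p ht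
    rwa [range_modelWithCornersEuclideanHalfSpace] at h
  target_mem_nhdsWithin t ht := by
    have h := extChartAt_target_mem_nhdsWithin_of_mem ht
    rw [range_modelWithCornersEuclideanHalfSpace] at h
    exact euclideanLine.symm.continuous.continuousWithinAt.tendsto_nhdsWithin (fun s hs => hs) h
  contMDiffOn_toFun := by
    have h : ContMDiffOn (𝓡∂ 1) (𝓡 1) ∞ (extChartAt (𝓡∂ 1) p) (extChartAt (𝓡∂ 1) p).source := by
      simpa only [extChartAt_source] using contMDiffOn_extChartAt
    exact euclideanLine.contDiff.contMDiff.comp_contMDiffOn h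
  contMDiffOn_symm := (contMDiffOn_extChartAt_symm p).comp
    euclideanLine.symm.contDiff.contMDiff.contMDiffOn fun t ht => ht

theorem contMDiffAt {x : M} (hx : x ∈ C.source) : ContMDiffAt (𝓡∂ 1) 𝓘(ℝ) ∞ C x :=
  C.contMDiffOn_toFun.contMDiffAt (C.open_source.mem_nhds hx)

theorem contMDiffWithinAt_symm (ht : t ∈ C.target) :
    ContMDiffWithinAt 𝓘(ℝ) (𝓡∂ 1) ∞ C.symm (Ici 0) t :=
  (C.contMDiffOn_symm t ht).mono_of_mem_nhdsWithin (C.target_mem_nhdsWithin t ht)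

theorem derivWithin_comp_symm_ne_zero {F : Type*} [NormedAddCommGroup F] [NormedSpace ℝ F]
    {e : M → F} (ht : t ∈ C.target) (he : MDifferentiableAt (𝓡∂ 1) 𝓘(ℝ, F) e (C.symm t))
    (hinj : Function.Injective (mfderiv (𝓡∂ 1) 𝓘(ℝ, F) e (C.symm t))) :
    derivWithin (e ∘ C.symm) (Ici 0) t ≠ 0 := by
  have huniq : UniqueMDiffWithinAt 𝓘(ℝ) (Ici (0 : ℝ)) t :=
    (uniqueDiffOn_Ici 0 t (C.target_nonneg t ht)).uniqueMDiffWithinAt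
  have hsymm := (C.contMDiffWithinAt_symm ht).mdifferentiableWithinAt (by simp)
  have hleft : C ∘ C.symm =ᶠ[𝓝[Ici 0] t] id := by
    filter_upwards [C.target_mem_nhdsWithin t ht] with s hs using C.right_inv hs
  have hCsymm : mfderivWithin 𝓘(ℝ) 𝓘(ℝ) (C ∘ C.symm) (Ici 0) t =
      (mfderiv (𝓡∂ 1) 𝓘(ℝ) C (C.symm t)).comp
        (mfderivWithin 𝓘(ℝ) (𝓡∂ 1) C.symm (Ici 0) t) :=
    mfderiv_comp_mfderivWithin t
      ((C.contMDiffAt (C.map_target ht)).mdifferentiableAt (by simp)) hsymm huniq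
  have hid : mfderivWithin 𝓘(ℝ) 𝓘(ℝ) (C ∘ C.symm) (Ici 0) t = ContinuousLinearMap.id ℝ ℝ :=
    (hleft.mfderivWithin_eq (C.right_inv ht)).trans (mfderivWithin_id huniq)
  have hecomp : mfderivWithin 𝓘(ℝ) 𝓘(ℝ, F) (e ∘ C.symm) (Ici 0) t =
      (mfderiv (𝓡∂ 1) 𝓘(ℝ, F) e (C.symm t)).comp
        (mfderivWithin 𝓘(ℝ) (𝓡∂ 1) C.symm (Ici 0) t) :=
    mfderiv_comp_mfderivWithin t he hsymm huniq
  rw [mfderivWithin_eq_fderivWithin] at hecomp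
  intro h0
  have hzero : mfderivWithin 𝓘(ℝ) (𝓡∂ 1) C.symm (Ici 0) t (1 : ℝ) = 0 :=
    hinj (((DFunLike.congr_fun hecomp (1 : ℝ)).symm.trans h0).trans (map_zero _).symm)
  have hone : (1 : ℝ) = mfderiv (𝓡∂ 1) 𝓘(ℝ) C (C.symm t)
      (mfderivWithin 𝓘(ℝ) (𝓡∂ 1) C.symm (Ici 0) t (1 : ℝ)) :=
    DFunLike.congr_fun (hid.symm.trans hCsymm) (1 : ℝ)
  rw [hzero, map_zero] at hone
  exact one_ne_zero (α := ℝ) hone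

theorem contDiffWithinAt_transition (C' : HalfLineChart M) (ht : t ∈ C.target)
    (ht' : C.symm t ∈ C'.source) :
    ContDiffWithinAt ℝ ∞ (C' ∘ C.symm) (Ici 0) t :=
  ((C'.contMDiffAt ht').comp_contMDiffWithinAt t (C.contMDiffWithinAt_symm ht)).contDiffWithinAt

end HalfLineChart

/-! ### Unit-speed charts -/

/-- A half-line chart whose inverse has unit speed, as measured in `F` through the map `e`. -/
structure UnitSpeedChart {M F : Type*} [TopologicalSpace M]
    [ChartedSpace (EuclideanHalfSpace 1) M] [NormedAddCommGroup F] [NormedSpace ℝ F] (e : M → F)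
    extends HalfLineChart M where
  unit_speed : ∀ t ∈ target, ∃ v, ‖v‖ = 1 ∧ HasDerivWithinAt (e ∘ toPartialEquiv.symm) v (Ici 0) t

namespace UnitSpeedChart

variable {M F : Type*} [TopologicalSpace M] [ChartedSpace (EuclideanHalfSpace 1) M]
  [NormedAddCommGroup F] [NormedSpace ℝ F] {e : M → F} (C C' : UnitSpeedChart e) {s s' : ℝ}

theorem hasDerivWithinAt_transition (hs : s ∈ C.target) (hs' : C.symm s ∈ C'.source) :
    HasDerivWithinAt (C'.toHalfLineChart ∘ C.symm)
        (derivWithin (C'.toHalfLineChart ∘ C.symm) (Ici 0) s) (Ici 0) s ∧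
      |derivWithin (C'.toHalfLineChart ∘ C.symm) (Ici 0) s| = 1 := by
  have hd := ((C.contDiffWithinAt_transition C'.toHalfLineChart hs hs').differentiableWithinAt
    (by simp)).hasDerivWithinAt
  refine ⟨hd, ?_⟩
  obtain ⟨v, hv, hvd⟩ := C.unit_speed s hs
  obtain ⟨v', hv', hvd'⟩ := C'.unit_speed _ (C'.map_source hs')
  have hA : Ici 0 ∩ C.symm ⁻¹' C'.source ∈ 𝓝[Ici 0] s := inter_mem self_mem_nhdsWithin
    (C.tendsto_symm hs (C'.open_source.mem_nhds hs'))
  have hcomp : HasDerivWithinAt (e ∘ C.symm)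
      (derivWithin (C'.toHalfLineChart ∘ C.symm) (Ici 0) s • v') (Ici 0) s :=
    ((hvd'.scomp s (hd.mono inter_subset_left) fun t ht =>
      C'.target_nonneg _ (C'.map_source ht.2)).congr
      (fun t ht => congrArg e (C'.left_inv ht.2).symm)
      (congrArg e (C'.left_inv hs').symm)).mono_of_mem_nhdsWithin hA
  rw [(uniqueDiffOn_Ici 0 s (C.target_nonneg s hs)).eq_deriv _ hvd hcomp, norm_smul, hv',
    mul_one] at hv
  exact hv

theorem exists_isometryEquiv_eventually_nonneg (hs : s ∈ C.target) (hs' : s' ∈ C'.target)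
    (h : C.symm s = C'.symm s') :
    ∃ φ : ℝ ≃ᵢ ℝ, φ s = s' ∧ ∀ᶠ t in 𝓝[Ici 0] s, 0 ≤ φ t ∧ C.symm t = C'.symm (φ t) := by
  have hsource : C.symm s ∈ C'.source := h ▸ C'.map_target hs'
  have hev : ∀ᶠ t in 𝓝[Ici 0] s, t ∈ C.target ∧ C.symm t ∈ C'.source :=
    Eventually.and (C.target_mem_nhdsWithin s hs)
      ((C.tendsto_symm hs).eventually (C'.open_source.mem_nhds hsource))
  have hd : ContinuousWithinAt (derivWithin (C'.toHalfLineChart ∘ C.symm) (Ici 0)) (Ici 0) s :=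
    ((C.contDiffWithinAt_transition C'.toHalfLineChart hs hsource).continuousWithinAt_fderivWithin
      (uniqueDiffOn_Ici 0) (by simp) (C.target_nonneg s hs)).clm_apply continuousWithinAt_const
  obtain ⟨φ, hφs, hφ⟩ := exists_realIsometryEquiv_eventuallyEq (convex_Ici 0)
    (C.target_nonneg s hs) hd (hev.mono fun t ht => C.hasDerivWithinAt_transition C' ht.1 ht.2)
  refine ⟨φ, by rw [hφs, Function.comp_apply, h, C'.right_inv hs'], ?_⟩
  filter_upwards [hev, hφ] with t ⟨_, ht'⟩ htφ
  rw [← htφ, Function.comp_apply, C'.left_inv ht']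
  exact ⟨C'.target_nonneg _ (C'.map_source ht'), rfl⟩

theorem pos_of_symm_eq (hs : s ∈ C.target) (hs0 : 0 < s) (hs' : s' ∈ C'.target)
    (h : C.symm s = C'.symm s') : 0 < s' := by
  obtain ⟨φ, rfl, hφ⟩ := C.exists_isometryEquiv_eventually_nonneg C' hs hs' h
  rw [nhdsWithin_eq_nhds.2 (Ici_mem_nhds hs0)] at hφ
  have hnonneg : Ici 0 ∈ 𝓝 (φ s) :=
    (φ.toHomeomorph.map_nhds_eq s).ge (hφ.mono fun t ht => ht.1)
  rwa [← mem_interior_iff_mem_nhds, interior_Ici] at hnonneg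

theorem exists_isometryEquiv_symm_abs_eventuallyEq (hs : |s| ∈ C.target) (hs' : |s'| ∈ C'.target)
    (h : C.symm |s| = C'.symm |s'|) :
    ∃ φ : ℝ ≃ᵢ ℝ, φ s = s' ∧ ∀ᶠ t in 𝓝 s, C.symm |t| = C'.symm |φ t| := by
  obtain ⟨φ, hφs, hφ⟩ := C.exists_isometryEquiv_eventually_nonneg C' hs hs' h
  replace hφ := (tendsto_abs_nhdsWithin_Ici s).eventually hφ
  obtain ⟨ρ', hρ', hρs', -⟩ := exists_isometryEquiv_abs_eq s'
  rcases eq_or_ne s 0 with rfl | hs0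
  · have hs0' : s' = 0 := by
      by_contra! hne
      simpa using C'.pos_of_symm_eq C hs' (abs_pos.2 hne) hs h.symm
    subst hs0'
    refine ⟨.refl ℝ, rfl, ?_⟩
    filter_upwards [hφ] with t ⟨ht0, ht⟩
    have hφ0 : φ 0 = 0 := by simpa using hφs
    have hφabs : |φ (|t|)| = |t| := by simpa [Real.dist_eq, hφ0] using φ.dist_eq |t| 0
    rwa [← abs_of_nonneg ht0, hφabs] at ht
  · obtain ⟨ρ, -, hρs, hρ⟩ := exists_isometryEquiv_abs_eq s
    refine ⟨ρ.symm.trans (φ.trans ρ'), ?_, ?_⟩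
    · simp [ρ.symm_apply_eq.2 hρs.symm, hφs, hρs']
    · filter_upwards [hφ, hρ hs0] with t ⟨ht0, ht⟩ htρ
      simp [ρ.symm_apply_eq.2 htρ.symm, hρ', abs_of_nonneg ht0, ht]

end UnitSpeedChart

namespace HalfLineChart

variable {M : Type*} [TopologicalSpace M] [ChartedSpace (EuclideanHalfSpace 1) M]

/-- The chart `S ∘ C`, restricted to the points where `C` takes values in `J`, for an increasing
change of coordinate `S` of the half-line. -/
def reparametrize (C : HalfLineChart M) (S : ℝ ≃o ℝ) {J : Set ℝ} (hS0 : S 0 = 0)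
    (hJC : J ⊆ C.target) (hJ : ∀ t ∈ J, J ∈ 𝓝[Ici 0] t) (hS : ContDiffOn ℝ ∞ S J)
    (hS' : ContDiffOn ℝ ∞ S.symm (S.symm ⁻¹' J)) : HalfLineChart M where
  toFun x := S (C x)
  invFun t := C.symm (S.symm t)
  source := C.source ∩ C ⁻¹' J
  target := S.symm ⁻¹' J
  map_source' x hx := by simpa using hx.2
  map_target' t ht := ⟨C.map_target (hJC ht), by simpa [C.right_inv (hJC ht)] using ht⟩
  left_inv' x hx := by simp [C.left_inv hx.1]
  right_inv' t ht := by simp [C.right_inv (hJC ht)]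
  open_source := isOpen_iff_mem_nhds.2 fun x hx =>
    inter_mem (C.open_source.mem_nhds hx.1) (C.tendsto_nhdsWithin_Ici hx.1 (hJ _ hx.2))
  target_nonneg t ht := by
    have h : 0 ≤ S.symm t := C.target_nonneg _ (hJC ht)
    rwa [S.le_symm_apply, hS0] at h
  target_mem_nhdsWithin t ht := by
    have hIci : MapsTo S.symm (Ici 0) (Ici 0) := fun s hs => by
      rwa [mem_Ici, S.le_symm_apply, hS0]
    exact S.symm.continuous.continuousWithinAt.tendsto_nhdsWithin hIci (hJ _ ht)
  contMDiffOn_toFun :=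
    hS.contMDiffOn.comp (C.contMDiffOn_toFun.mono inter_subset_left) fun _ hx => hx.2
  contMDiffOn_symm := C.contMDiffOn_symm.comp hS'.contMDiffOn fun _ ht => hJC ht

section

variable (C : HalfLineChart M) {F : Type*} [NormedAddCommGroup F] [NormedSpace ℝ F] {e : M → F}

theorem hasDerivWithinAt_comp_symm (he : ContMDiff (𝓡∂ 1) 𝓘(ℝ, F) ∞ e) {t : ℝ}
    (ht : t ∈ C.target) :
    HasDerivWithinAt (e ∘ C.symm) (derivWithin (e ∘ C.symm) (Ici 0) t) (Ici 0) t :=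
  ((he.contMDiffAt.comp_contMDiffWithinAt t
    (C.contMDiffWithinAt_symm ht)).contDiffWithinAt.differentiableWithinAt
      (by simp)).hasDerivWithinAt

theorem contDiffOn_derivWithin_comp_symm (he : ContMDiff (𝓡∂ 1) 𝓘(ℝ, F) ∞ e) :
    ContDiffOn ℝ ∞ (derivWithin (e ∘ C.symm) (Ici 0)) C.target := by
  have hf : ContDiffOn ℝ ∞ (e ∘ C.symm) C.target :=
    (he.comp_contMDiffOn C.contMDiffOn_symm).contDiffOn
  refine ((contDiffOn_infty_iff_derivWithin C.uniqueDiffOn_target).1 hf).2.congr fun t ht => ?_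
  exact (((C.hasDerivWithinAt_comp_symm he ht).mono C.target_nonneg).derivWithin
    (C.uniqueDiffOn_target t ht)).symm

end

end HalfLineChart

theorem exists_unitSpeedChart {M F : Type*} [TopologicalSpace M]
    [ChartedSpace (EuclideanHalfSpace 1) M] [IsManifold (𝓡∂ 1) ∞ M] [NormedAddCommGroup F]
    [InnerProductSpace ℝ F] {e : M → F} (he : ContMDiff (𝓡∂ 1) 𝓘(ℝ, F) ∞ e)
    (hinj : ∀ x, Function.Injective (mfderiv (𝓡∂ 1) 𝓘(ℝ, F) e x)) (p : M) :
    ∃ C : UnitSpeedChart e, p ∈ C.source := by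
  let C := HalfLineChart.ofChartAt p
  have hp : p ∈ C.source := mem_extChartAt_source p
  let g := derivWithin (e ∘ C.symm) (Ici 0)
  have hg0 : ∀ t ∈ C.target, g t ≠ 0 := fun t ht =>
    C.derivWithin_comp_symm_ne_zero ht (he.mdifferentiableAt (by simp)) (hinj _)
  obtain ⟨ε, hε, hball⟩ := (nhdsWithin_hasBasis Metric.nhds_basis_closedBall _).mem_iff.1
    (C.target_mem_nhdsWithin (C p) (C.map_source hp))
  have hJK : Metric.ball (C p) ε ∩ Ici 0 ⊆ Metric.closedBall (C p) ε ∩ Ici 0 :=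
    inter_subset_inter_left _ Metric.ball_subset_closedBall
  have hJ : ∀ t ∈ Metric.ball (C p) ε ∩ Ici 0, Metric.ball (C p) ε ∩ Ici 0 ∈ 𝓝[Ici 0] t :=
    fun t ht => inter_mem (mem_nhdsWithin_of_mem_nhds (Metric.isOpen_ball.mem_nhds ht.1))
      self_mem_nhdsWithin
  obtain ⟨S, hS0, hS, hS', hSd⟩ := exists_orderIso_contDiffOn
    ((isCompact_closedBall (C p) ε).inter_right isClosed_Ici) hJK
    (fun t ht => ((uniqueDiffOn_Ici 0 t ht.2).mono_nhds (nhdsWithin_le_of_mem (hJ t ht))))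
    (((C.contDiffOn_derivWithin_comp_symm he).norm ℝ hg0).mono hball)
    fun t ht => norm_pos_iff.2 (hg0 t (hball ht))
  refine ⟨⟨C.reparametrize S hS0 (hJK.trans hball) hJ hS hS', fun t ht => ?_⟩, hp,
    Metric.mem_ball_self hε, C.target_nonneg _ (C.map_source hp)⟩
  have htC : S.symm t ∈ C.target := hball (hJK ht)
  refine ⟨‖g (S.symm t)‖⁻¹ • g (S.symm t), norm_smul_inv_norm (𝕜 := ℝ) (hg0 _ htC), ?_⟩
  exact (C.hasDerivWithinAt_comp_symm he htC).scomp t (hSd t ht).hasDerivWithinAt fun s hs => by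
    rwa [mem_Ici, S.le_symm_apply, hS0]

/-! ### Unit-speed curves -/

section UnitSpeedCurve

variable {M : Type*} [TopologicalSpace M] [ChartedSpace (EuclideanHalfSpace 1) M]

/-- Near `a`, the curve `γ` is a unit speed parametrization of `M`, which runs back along itself
when it reaches the boundary: the folding is the absolute value in `|ψ t|`. -/
def IsUnitSpeedAt {F : Type*} [NormedAddCommGroup F] [NormedSpace ℝ F] (e : M → F) (γ : ℝ → M)
    (a : ℝ) : Prop :=
  ∃ (C : UnitSpeedChart e) (ψ : ℝ ≃ᵢ ℝ), |ψ a| ∈ C.target ∧ ∀ᶠ t in 𝓝 a, γ t = C.symm |ψ t|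

/-- Near `a` and within `K`, the curve `γ` is the inverse of a half-line chart, up to an isometry
of the line. This excludes a turn at the boundary inside `K`, so that `γ` is smooth there and has
smooth local inverses. -/
def IsUnfoldedAt (γ : ℝ → M) (K : Set ℝ) (a : ℝ) : Prop :=
  ∃ (C : HalfLineChart M) (φ : ℝ ≃ᵢ ℝ), ∀ᶠ t in 𝓝[K] a, φ t ∈ C.target ∧ γ t = C.symm (φ t)

namespace HalfLineChart

variable (C : HalfLineChart M) {γ : ℝ → M} {K : Set ℝ} {a : ℝ} {φ ψ : ℝ ≃ᵢ ℝ}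

theorem isUnfoldedAt_of_eventually_abs_eq (ha : |ψ a| ∈ C.target)
    (hγ : ∀ᶠ t in 𝓝 a, γ t = C.symm |ψ t|) (hφ : ∀ᶠ t in 𝓝[K] a, |ψ t| = φ t) :
    IsUnfoldedAt γ K a := by
  refine ⟨C, φ, ?_⟩
  have htarget : ∀ᶠ t in 𝓝 a, |ψ t| ∈ C.target :=
    (ψ.continuous.tendsto a).eventually (C.eventually_abs_mem_target ha)
  filter_upwards [nhdsWithin_le_nhds hγ, nhdsWithin_le_nhds htarget, hφ] with t ht htC htφ
  exact htφ ▸ ⟨htC, ht⟩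

theorem isUnfoldedAt_univ (ha : |ψ a| ∈ C.target) (ha0 : ψ a ≠ 0)
    (hγ : ∀ᶠ t in 𝓝 a, γ t = C.symm |ψ t|) : IsUnfoldedAt γ univ a := by
  obtain ⟨ρ, -, -, hρ⟩ := exists_isometryEquiv_abs_eq (ψ a)
  refine C.isUnfoldedAt_of_eventually_abs_eq ha hγ (φ := ψ.trans ρ.symm) (nhdsWithin_le_nhds ?_)
  exact ((ψ.continuous.tendsto a).eventually (hρ ha0)).mono fun t ht => ρ.eq_symm_apply.2 ht

end HalfLineChart

namespace IsUnfoldedAt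

variable {γ : ℝ → M} {K : Set ℝ} {a : ℝ}

theorem mono {K' : Set ℝ} (h : IsUnfoldedAt γ K a) (hK : K' ⊆ K) : IsUnfoldedAt γ K' a :=
  let ⟨C, φ, hφ⟩ := h
  ⟨C, φ, hφ.filter_mono (nhdsWithin_mono a hK)⟩

theorem exists_injOn (h : IsUnfoldedAt γ K a) : ∃ V ∈ 𝓝[K] a, InjOn γ V := by
  obtain ⟨C, φ, hφ⟩ := h
  refine ⟨_, hφ, fun s hs t ht hst => φ.injective (C.symm.injOn hs.1 ht.1 ?_)⟩
  rw [← hs.2, ← ht.2, hst]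

theorem contMDiffWithinAt (h : IsUnfoldedAt γ K a) (ha : a ∈ K) :
    ContMDiffWithinAt 𝓘(ℝ) (𝓡∂ 1) ∞ γ K a := by
  obtain ⟨C, φ, hφ⟩ := h
  have hφa := hφ.self_of_nhdsWithin ha
  have hcomp : ContMDiffWithinAt 𝓘(ℝ) (𝓡∂ 1) ∞ (C.symm ∘ φ) (K ∩ φ ⁻¹' C.target) a :=
    (C.contMDiffOn_symm _ hφa.1).comp a
      (contDiff_realIsometryEquiv φ).contMDiff.contMDiffAt.contMDiffWithinAt inter_subset_right
  refine (hcomp.mono_of_mem_nhdsWithin ?_).congr_of_eventuallyEq (hφ.mono fun t ht => ht.2) hφa.2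
  exact inter_mem self_mem_nhdsWithin (hφ.mono fun t ht => ht.1)

theorem contMDiffAt_section {τ : M → ℝ} {x : M} (h : IsUnfoldedAt γ K (τ x))
    (hτ : ContinuousAt τ x) (hτγ : ∀ᶠ y in 𝓝 x, τ y ∈ K ∧ γ (τ y) = y) :
    ContMDiffAt (𝓡∂ 1) 𝓘(ℝ) ∞ τ x := by
  obtain ⟨C, φ, hφ⟩ := h
  have hev : ∀ᶠ y in 𝓝 x, φ (τ y) ∈ C.target ∧ y = C.symm (φ (τ y)) := by
    have hτK : Tendsto τ (𝓝 x) (𝓝[K] τ x) :=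
      tendsto_nhdsWithin_iff.2 ⟨hτ, hτγ.mono fun y hy => hy.1⟩
    filter_upwards [hτK.eventually hφ, hτγ] with y hy hyγ
    exact ⟨hy.1, hyγ.2.symm.trans hy.2⟩
  have hx : x ∈ C.source := by
    obtain ⟨hxC, hx⟩ := hev.self_of_nhds
    exact hx ▸ C.map_target hxC
  have hτC : τ =ᶠ[𝓝 x] φ.symm ∘ C := by
    filter_upwards [hev] with y ⟨hy, hy'⟩
    rw [Function.comp_apply, hy', C.right_inv hy, φ.symm_apply_apply, ← hy']
  exact ((contDiff_realIsometryEquiv φ.symm).contMDiff.contMDiffAt.comp x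
    (C.contMDiffAt hx)).congr_of_eventuallyEq hτC

end IsUnfoldedAt

namespace IsUnitSpeedAt

variable {F : Type*} [NormedAddCommGroup F] [NormedSpace ℝ F] {e : M → F} {γ δ : ℝ → M} {a b : ℝ}

theorem congr (h : IsUnitSpeedAt e γ a) (hγδ : γ =ᶠ[𝓝 a] δ) : IsUnitSpeedAt e δ a :=
  let ⟨C, ψ, ha, hγ⟩ := h
  ⟨C, ψ, ha, hγδ.symm.trans hγ⟩

theorem comp_isometryEquiv {φ : ℝ ≃ᵢ ℝ} (h : IsUnitSpeedAt e γ (φ a)) :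
    IsUnitSpeedAt e (γ ∘ φ) a :=
  let ⟨C, ψ, ha, hγ⟩ := h
  ⟨C, φ.trans ψ, ha, (φ.continuous.tendsto a).eventually hγ⟩

theorem continuousAt (h : IsUnitSpeedAt e γ a) : ContinuousAt γ a := by
  obtain ⟨C, ψ, ha, hγ⟩ := h
  exact ((C.continuousAt_symm_abs ha).comp ψ.continuous.continuousAt).congr
    (hγ.mono fun _ => Eq.symm)

theorem image_mem_nhds (h : IsUnitSpeedAt e γ a) {V : Set ℝ} (hV : V ∈ 𝓝 a) :
    γ '' V ∈ 𝓝 (γ a) := by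
  obtain ⟨C, ψ, ha, hγ⟩ := h
  have hψV : ψ '' (V ∩ {t | γ t = C.symm |ψ t|}) ∈ 𝓝 (ψ a) :=
    ψ.toHomeomorph.isOpenMap.image_mem_nhds (inter_mem hV hγ)
  rw [hγ.self_of_nhds]
  refine mem_of_superset (C.image_symm_abs_mem_nhds ha hψV) ?_
  rintro _ ⟨_, ⟨t, ⟨htV, ht⟩, rfl⟩, rfl⟩
  exact ⟨t, htV, ht⟩

theorem exists_eventuallyEq_comp (h : IsUnitSpeedAt e γ a) (h' : IsUnitSpeedAt e δ b)
    (hab : γ a = δ b) : ∃ φ : ℝ ≃ᵢ ℝ, φ a = b ∧ γ =ᶠ[𝓝 a] δ ∘ φ := by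
  obtain ⟨C, ψ, ha, hγ⟩ := h
  obtain ⟨C', ψ', hb, hδ⟩ := h'
  obtain ⟨φ, hφa, hφ⟩ := C.exists_isometryEquiv_symm_abs_eventuallyEq C' ha hb
    (by rw [← hγ.self_of_nhds, ← hδ.self_of_nhds, hab])
  have hb' : (ψ.trans (φ.trans ψ'.symm)) a = b := by simp [hφa]
  refine ⟨ψ.trans (φ.trans ψ'.symm), hb', ?_⟩
  filter_upwards [hγ, (ψ.continuous.tendsto a).eventually hφ,
    (hb' ▸ (ψ.trans (φ.trans ψ'.symm)).continuous.tendsto a).eventually hδ] with t ht htφ htδ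
  rw [ht, htφ, Function.comp_apply, htδ]
  simp

theorem isUnfoldedAt_univ_or_comp_eventuallyEq (h : IsUnitSpeedAt e γ a) :
    IsUnfoldedAt γ univ a ∨ ∀ φ : ℝ ≃ᵢ ℝ, φ a = a → γ ∘ φ =ᶠ[𝓝 a] γ := by
  obtain ⟨C, ψ, ha, hγ⟩ := h
  rcases eq_or_ne (ψ a) 0 with ha0 | ha0
  · refine .inr fun φ hφ => ?_
    filter_upwards [hγ, (hφ ▸ φ.continuous.tendsto a).eventually hγ] with t ht htφ
    have habs : ∀ s, |ψ s| = dist s a := fun s => by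
      rw [← ψ.dist_eq, ha0, Real.dist_eq, sub_zero]
    calc γ (φ t) = C.symm |ψ (φ t)| := htφ
      _ = C.symm |ψ t| := by rw [habs, habs, ← φ.dist_eq t a, hφ]
      _ = γ t := ht.symm
  · exact .inl (C.isUnfoldedAt_univ ha ha0 hγ)

theorem isUnfoldedAt_of_subset_Ici_or_Iic (h : IsUnitSpeedAt e γ a) {K : Set ℝ}
    (hK : K ⊆ Ici a ∨ K ⊆ Iic a) : IsUnfoldedAt γ K a := by
  obtain ⟨C, ψ, ha, hγ⟩ := h
  rcases eq_or_ne (ψ a) 0 with ha0 | ha0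
  · have habs : ∀ t, |ψ t| = |t - a| := fun t => by
      rw [← Real.dist_eq t a, ← ψ.dist_eq, ha0, Real.dist_eq, sub_zero]
    rcases hK with hK | hK
    · refine C.isUnfoldedAt_of_eventually_abs_eq ha hγ (φ := .subRight a) ?_
      filter_upwards [self_mem_nhdsWithin] with t ht
      rw [habs, abs_of_nonneg (sub_nonneg.2 (mem_Ici.1 (hK ht))), IsometryEquiv.subRight_apply]
    · refine C.isUnfoldedAt_of_eventually_abs_eq ha hγ (φ := .subLeft a) ?_
      filter_upwards [self_mem_nhdsWithin] with t ht
      rw [habs, abs_sub_comm, abs_of_nonneg (sub_nonneg.2 (mem_Iic.1 (hK ht))),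
        IsometryEquiv.subLeft_apply]
  · exact (C.isUnfoldedAt_univ ha ha0 hγ).mono (subset_univ K)

theorem isUnfoldedAt_of_injOn (h : IsUnitSpeedAt e γ a) {K : Set ℝ} (hK : K.OrdConnected)
    (hinj : InjOn γ K) : IsUnfoldedAt γ K a := by
  rcases h.isUnfoldedAt_univ_or_comp_eventuallyEq with hunf | heven
  · exact hunf.mono (subset_univ K)
  refine h.isUnfoldedAt_of_subset_Ici_or_Iic ?_
  by_contra! hcon
  obtain ⟨⟨x, hx, hxa⟩, ⟨y, hy, hya⟩⟩ := And.imp not_subset.1 not_subset.1 hcon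
  rw [mem_Ici, not_le] at hxa
  rw [mem_Iic, not_le] at hya
  have hIoo : Ioo x y ∈ 𝓝 a := Ioo_mem_nhds hxa hya
  have hrefl : ∀ᶠ t in 𝓝[≠] a, γ (2 * a - t) = γ t ∧ t ∈ Ioo x y ∧ 2 * a - t ∈ Ioo x y := by
    have hcont : Tendsto (fun t => 2 * a - t) (𝓝 a) (𝓝 a) :=
      Continuous.tendsto' (by fun_prop) a a (by ring)
    exact nhdsWithin_le_nhds <| (heven (.subLeft (2 * a)) (by simp [two_mul])).and <|
      (eventually_mem_set.2 hIoo).and (hcont.eventually_mem hIoo)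
  obtain ⟨t, ⟨hγt, ht, ht'⟩, hta⟩ := (hrefl.and self_mem_nhdsWithin).exists
  have hK' : Ioo x y ⊆ K := Ioo_subset_Icc_self.trans (hK.out hx hy)
  exact hta (show t = a by linarith [hinj (hK' ht') (hK' ht) hγt])

end IsUnitSpeedAt

theorem eqOn_of_isUnitSpeedAt {F : Type*} [NormedAddCommGroup F] [NormedSpace ℝ F] {e : M → F}
    {γ δ : ℝ → M} [T2Space M] {U : Set ℝ} (hU : IsPreconnected U)
    (hγ : ∀ t ∈ U, IsUnitSpeedAt e γ t) (hδ : ∀ t ∈ U, IsUnitSpeedAt e δ t) {a : ℝ} (ha : a ∈ U)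
    (h : γ =ᶠ[𝓝 a] δ) : EqOn γ δ U := by
  suffices hsub : U ⊆ {t | γ =ᶠ[𝓝 t] δ} from fun t ht => (hsub ht).eq_of_nhds
  refine hU.subset_of_closure_inter_subset isOpen_setOfPred_eventually_nhds ⟨a, ha, h⟩ ?_
  rintro t ⟨htc, htU⟩
  rw [mem_closure_iff_frequently] at htc
  have heq : γ t = δ t := by
    by_contra hne
    have hev := ((hγ t htU).continuousAt.ne_iff_eventually_ne (hδ t htU).continuousAt).1 hne
    exact htc (hev.mono fun s hs h' => hs h'.self_of_nhds)
  obtain ⟨φ, hφt, hφ⟩ := (hγ t htU).exists_eventuallyEq_comp (hδ t htU) heq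
  -- Without folding at `t`, local injectivity makes `φ` fix the nearby points of agreement; with
  -- folding, every isometry fixing `t` preserves `δ` near `t`.
  rcases (hδ t htU).isUnfoldedAt_univ_or_comp_eventuallyEq with hunf | heven
  · obtain ⟨V, hV, hinj⟩ := hunf.exists_injOn
    rw [nhdsWithin_univ] at hV
    obtain ⟨s, hs, hsφ, hsV, hsV'⟩ := (htc.and_eventually
      (hφ.and ((eventually_mem_set.2 hV).and
        ((hφt ▸ φ.continuous.tendsto t).eventually_mem hV)))).exists
    have hφs : φ s = s := hinj hsV' hsV (hsφ.symm.trans hs.eq_of_nhds)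
    rcases eq_or_eq_reflection_of_realIsometryEquiv_apply_eq_self hφt with hid | hrefl
    · exact hφ.trans (.of_eq (funext fun x => by simp [hid]))
    · have hst : s = t := by linarith [hrefl s]
      exact hst ▸ hs
  · exact hφ.trans (heven φ hφt)

section

variable {F : Type*} [NormedAddCommGroup F] [NormedSpace ℝ F] {e : M → F} {γ δ : ℝ → M}
  {s t ε R : ℝ}

theorem UnitSpeedChart.exists_nhds_forall_exists_isUnitSpeedAt (C : UnitSpeedChart e) {p : M}
    (hp : p ∈ C.source) :
    ∃ U ∈ 𝓝 p, ∃ ε > 0, ∀ q ∈ U, ∃ γ : ℝ → M,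
      γ 0 = q ∧ ∀ t ∈ Metric.ball 0 ε, IsUnitSpeedAt e γ t := by
  have hCp := C.map_source hp
  rw [← abs_of_nonneg (C.target_nonneg _ hCp)] at hCp
  obtain ⟨ε, hε, hball⟩ := Metric.eventually_nhds_iff_ball.1 (C.eventually_abs_mem_target hCp)
  have hcont : Tendsto C.toHalfLineChart (𝓝 p) (𝓝 (C.toHalfLineChart p)) :=
    (C.tendsto_nhdsWithin_Ici hp).mono_right nhdsWithin_le_nhds
  refine ⟨_, (C.open_source.eventually_mem hp).and
    (hcont.eventually_mem (Metric.ball_mem_nhds _ (half_pos hε))), ε / 2, half_pos hε, ?_⟩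
  rintro q ⟨hq, hqp⟩
  refine ⟨fun t => C.symm |C.toHalfLineChart q + t|, ?_, fun t ht =>
    ⟨C, .addLeft (C.toHalfLineChart q), hball _ ?_, .of_forall fun _ => rfl⟩⟩
  · beta_reduce
    rw [add_zero, abs_of_nonneg (C.target_nonneg _ (C.map_source hq)), C.left_inv hq]
  · rw [mem_ball_iff_norm] at hqp ht ⊢
    rw [sub_zero] at ht
    set c := C.toHalfLineChart
    calc ‖c q + t - c p‖ = ‖(c q - c p) + t‖ := by ring_nf
      _ ≤ ‖c q - c p‖ + ‖t‖ := norm_add_le _ _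
      _ < ε := by linarith

theorem exists_pos_forall_exists_isUnitSpeedAt [CompactSpace M]
    (hC : ∀ p, ∃ C : UnitSpeedChart e, p ∈ C.source) :
    ∃ ε > 0, ∀ q, ∃ γ : ℝ → M, γ 0 = q ∧ ∀ t ∈ Metric.ball 0 ε, IsUnitSpeedAt e γ t := by
  suffices h : ∃ ε > 0, ∀ q ∈ (univ : Set M), ∃ γ : ℝ → M,
      γ 0 = q ∧ ∀ t ∈ Metric.ball 0 ε, IsUnitSpeedAt e γ t by simpa using h
  refine isCompact_univ.induction_on ⟨1, one_pos, by simp⟩ ?_ ?_ fun p _ => ?_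
  · rintro S T hST ⟨ε, hε, h⟩
    exact ⟨ε, hε, fun q hq => h q (hST hq)⟩
  · rintro S T ⟨ε, hε, h⟩ ⟨ε', hε', h'⟩
    refine ⟨min ε ε', lt_min hε hε', ?_⟩
    rintro q (hq | hq)
    · obtain ⟨γ, hγ, hu⟩ := h q hq
      exact ⟨γ, hγ, fun t ht => hu t (Metric.ball_subset_ball (min_le_left _ _) ht)⟩
    · obtain ⟨γ, hγ, hu⟩ := h' q hq
      exact ⟨γ, hγ, fun t ht => hu t (Metric.ball_subset_ball (min_le_right _ _) ht)⟩
  · obtain ⟨C, hp⟩ := hC p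
    obtain ⟨U, hU, h⟩ := C.exists_nhds_forall_exists_isUnitSpeedAt hp
    exact ⟨U, nhdsWithin_le_nhds hU, h⟩

theorem IsUnitSpeedAt.ite_le (hγδ : γ =ᶠ[𝓝 s] δ) (hγ : t ≤ s → IsUnitSpeedAt e γ t)
    (hδ : s < t → IsUnitSpeedAt e δ t) :
    IsUnitSpeedAt e (fun x => if x ≤ s then γ x else δ x) t := by
  rcases lt_trichotomy t s with hts | rfl | hts
  · refine (hγ hts.le).congr ((gt_mem_nhds hts).mono fun x hx => ?_)
    exact (if_pos (le_of_lt hx)).symm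
  · refine (hγ le_rfl).congr (hγδ.mono fun x hx => ?_)
    beta_reduce
    rw [← hx, ite_self]
  · refine (hδ hts).congr ((lt_mem_nhds hts).mono fun x hx => ?_)
    exact (if_neg (not_le.2 hx)).symm

theorem IsUnitSpeedAt.exists_eventuallyEq (hs : IsUnitSpeedAt e γ s) (hε : 0 < ε)
    (hloc : ∀ q, ∃ γ : ℝ → M, γ 0 = q ∧ ∀ t ∈ Metric.ball 0 ε, IsUnitSpeedAt e γ t) :
    ∃ δ, γ =ᶠ[𝓝 s] δ ∧ ∀ t ∈ Metric.ball s ε, IsUnitSpeedAt e δ t := by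
  obtain ⟨δ, hδs, hδ⟩ := hloc (γ s)
  obtain ⟨φ, hφs, hφ⟩ := hs.exists_eventuallyEq_comp (hδ 0 (Metric.mem_ball_self hε)) hδs.symm
  refine ⟨δ ∘ φ, hφ, fun t ht => .comp_isometryEquiv (hδ _ ?_)⟩
  rwa [Metric.mem_ball, ← hφs, φ.dist_eq]

theorem exists_isUnitSpeedAt_ball_add_half (hε : 0 < ε)
    (hloc : ∀ q, ∃ γ : ℝ → M, γ 0 = q ∧ ∀ t ∈ Metric.ball 0 ε, IsUnitSpeedAt e γ t)
    (hR : ε ≤ R) (hγ : ∀ t ∈ Metric.ball 0 R, IsUnitSpeedAt e γ t) :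
    ∃ δ, γ =ᶠ[𝓝 0] δ ∧ ∀ t ∈ Metric.ball 0 (R + ε / 2), IsUnitSpeedAt e δ t := by
  simp only [Real.ball_eq_Ioo, zero_sub, zero_add, mem_Ioo] at hγ ⊢
  obtain ⟨s, rfl⟩ : ∃ s, R = s + ε / 2 := ⟨R - ε / 2, by ring⟩
  obtain ⟨δ, hδ, hδ'⟩ := (hγ s (by constructor <;> linarith)).exists_eventuallyEq hε hloc
  obtain ⟨η, hη, hη'⟩ := (hγ (-s) (by constructor <;> linarith)).exists_eventuallyEq hε hloc
  simp only [Real.ball_eq_Ioo, mem_Ioo] at hδ' hη'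
  refine ⟨fun t => if t ≤ -s then η t else if t ≤ s then γ t else δ t, ?_, fun t ht => ?_⟩
  · filter_upwards [Ioo_mem_nhds (show -s < 0 by linarith) (show 0 < s by linarith)] with t ht
    rw [if_neg (not_le.2 ht.1), if_pos ht.2.le]
  · refine .ite_le (hη.symm.trans ?_) (fun hts => hη' t (by constructor <;> linarith))
      fun hts => .ite_le hδ (fun hts' => hγ t (by constructor <;> linarith))
        fun hts' => hδ' t (by constructor <;> linarith)
    filter_upwards [gt_mem_nhds (show -s < s by linarith)] with t ht
    rw [if_pos (le_of_lt ht)]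

theorem exists_forall_isUnitSpeedAt [T2Space M] [Nonempty M] (hε : 0 < ε)
    (hloc : ∀ q, ∃ γ : ℝ → M, γ 0 = q ∧ ∀ t ∈ Metric.ball 0 ε, IsUnitSpeedAt e γ t) :
    ∃ γ : ℝ → M, ∀ t, IsUnitSpeedAt e γ t := by
  obtain ⟨γ₀, -, hγ₀⟩ := hloc (Classical.arbitrary M)
  have hnat : ∀ n : ℕ, ∃ γ, γ₀ =ᶠ[𝓝 0] γ ∧
      ∀ t ∈ Metric.ball 0 (ε + n * (ε / 2)), IsUnitSpeedAt e γ t := fun n => by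
    induction n with
    | zero => exact ⟨γ₀, .rfl, by simpa using hγ₀⟩
    | succ n ih =>
      obtain ⟨γ, h₀, hγ⟩ := ih
      obtain ⟨δ, hγδ, hδ⟩ := exists_isUnitSpeedAt_ball_add_half hε hloc
        (le_add_of_nonneg_right (by positivity)) hγ
      exact ⟨δ, h₀.trans hγδ, by convert hδ using 4; push_cast; ring⟩
  have hreal : ∀ R : ℝ, ∃ γ, γ₀ =ᶠ[𝓝 0] γ ∧ ∀ t ∈ Metric.ball 0 R, IsUnitSpeedAt e γ t :=
    fun R => by
      obtain ⟨n, hn⟩ := exists_nat_gt (R / (ε / 2))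
      rw [div_lt_iff₀ (half_pos hε)] at hn
      obtain ⟨γ, h₀, hγ⟩ := hnat n
      exact ⟨γ, h₀, fun t ht => hγ t (Metric.ball_subset_ball (by linarith) ht)⟩
  choose γ h₀ hγ using hreal
  have hagree : ∀ R R' t, |t| < R → R ≤ R' → γ R t = γ R' t := fun R R' t ht hR => by
    refine eqOn_of_isUnitSpeedAt (convex_ball 0 R).isPreconnected (hγ R)
      (fun t ht => hγ R' t (Metric.ball_subset_ball hR ht))
      (Metric.mem_ball_self ((abs_nonneg t).trans_lt ht)) ((h₀ R).symm.trans (h₀ R')) ?_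
    rwa [Metric.mem_ball, Real.dist_0_eq_abs]
  refine ⟨fun t => γ (|t| + 1) t, fun t => (hγ (|t| + 2) t (by simp)).congr ?_⟩
  filter_upwards [continuous_abs.continuousAt.eventually (gt_mem_nhds (lt_add_one |t|))] with x hx
  exact (hagree _ _ x (lt_add_one _) (by linarith)).symm

theorem surjective_of_forall_isUnitSpeedAt [T2Space M] [PreconnectedSpace M] (hε : 0 < ε)
    (hloc : ∀ q, ∃ γ : ℝ → M, γ 0 = q ∧ ∀ t ∈ Metric.ball 0 ε, IsUnitSpeedAt e γ t)
    (hγ : ∀ t, IsUnitSpeedAt e γ t) : Function.Surjective γ := by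
  have hopen : IsOpen (range γ) := by
    rw [isOpen_iff_mem_nhds]
    rintro _ ⟨t, rfl⟩
    simpa using (hγ t).image_mem_nhds univ_mem
  have hclosed : IsClosed (range γ) := by
    refine isClosed_of_closure_subset fun q hq => ?_
    obtain ⟨δ, rfl, hδ⟩ := hloc q
    have h0 : (0 : ℝ) ∈ Metric.ball 0 ε := Metric.mem_ball_self hε
    obtain ⟨_, ⟨s, hs, rfl⟩, t, hst⟩ := mem_closure_iff_nhds.1 hq _
      ((hδ 0 h0).image_mem_nhds (Metric.ball_mem_nhds 0 hε))
    obtain ⟨φ, -, hφ⟩ := (hδ s hs).exists_eventuallyEq_comp (hγ t) hst.symm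
    exact ⟨φ 0, (eqOn_of_isUnitSpeedAt (convex_ball 0 ε).isPreconnected hδ
      (fun t _ => (hγ _).comp_isometryEquiv) hs hφ h0).symm⟩
  rw [← range_eq_univ]
  exact (isClopen_iff.1 ⟨hclosed, hopen⟩).resolve_left (range_nonempty γ).ne_empty

theorem exists_isometryEquiv_comp_eq_of_eq [T2Space M] (hγ : ∀ t, IsUnitSpeedAt e γ t)
    (h : γ s = γ t) : ∃ φ : ℝ ≃ᵢ ℝ, φ s = t ∧ γ ∘ φ = γ := by
  obtain ⟨φ, hφs, hφ⟩ := (hγ s).exists_eventuallyEq_comp (hγ t) h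
  exact ⟨φ, hφs, (eqOn_univ _ _).1 (eqOn_of_isUnitSpeedAt isPreconnected_univ
    (fun t _ => (hγ _).comp_isometryEquiv) (fun t _ => hγ t) (mem_univ s) hφ.symm)⟩

end

end UnitSpeedCurve

/-! ### Periods -/

section Periodic

variable {X : Type*} {γ : ℝ → X} {L : ℝ}

theorem exists_pos_forall_periodic_iff {V : Set ℝ} (hV : V ∈ 𝓝[≥] 0) (hinj : InjOn γ V)
    (hL : γ.Periodic L) (hL0 : L ≠ 0) :
    ∃ T > 0, ∀ x, γ.Periodic x ↔ ∃ n : ℤ, x = n * T := by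
  let P : AddSubgroup ℝ :=
    { carrier := {x | γ.Periodic x}
      zero_mem' := fun t => by rw [add_zero]
      add_mem' := Function.Periodic.add_period
      neg_mem' := Function.Periodic.neg }
  obtain ⟨ε, hε, hεV⟩ := mem_nhdsGE_iff_exists_Ico_subset.1 hV
  have hisolated : Disjoint (P : Set ℝ) (Ioo 0 ε) := Set.disjoint_left.2 fun x hx hxε =>
    hxε.1.ne' (hinj (hεV (Ioo_subset_Ico_self hxε)) (hεV (left_mem_Ico.2 hε)) hx.eq)
  obtain ⟨b, hb⟩ := AddSubgroup.cyclic_of_isolated_zero hε hisolated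
  have hmem : ∀ x, γ.Periodic x ↔ ∃ n : ℤ, x = n * b := fun x => by
    change x ∈ P ↔ _
    simp only [hb, AddSubgroup.mem_closure_singleton, zsmul_eq_mul, eq_comm]
  have hb0 : b ≠ 0 := by
    rintro rfl
    obtain ⟨n, hn⟩ := (hmem L).1 hL
    exact hL0 (by simpa using hn)
  refine ⟨|b|, abs_pos.2 hb0, fun x => (hmem x).trans ?_⟩
  rcases abs_choice b with h | h <;> rw [h]
  constructor <;> rintro ⟨n, rfl⟩ <;> exact ⟨-n, by push_cast; ring⟩

theorem eq_zero_of_periodic_of_abs_lt (hperiod : ∀ x, γ.Periodic x ↔ ∃ n : ℤ, x = n * L) {x : ℝ}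
    (hx : γ.Periodic x) (hxL : |x| < L) : x = 0 := by
  obtain ⟨n, rfl⟩ := (hperiod x).1 hx
  have hL : 0 < L := (abs_nonneg _).trans_lt hxL
  rw [abs_mul, abs_of_pos hL, mul_lt_iff_lt_one_left hL] at hxL
  simp [Int.abs_lt_one_iff.1 (mod_cast hxL)]

theorem injOn_Icc_half_period (hperiod : ∀ x, γ.Periodic x ↔ ∃ n : ℤ, x = n * L)
    (hfib : ∀ a b, γ a = γ b → γ.Periodic (b - a) ∨ γ.Periodic (a + b)) :
    InjOn γ (Icc 0 (L / 2)) := by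
  intro s hs t ht hst
  have hsmall := fun {x} => eq_zero_of_periodic_of_abs_lt hperiod (x := x)
  by_contra hne
  have hlt : |t - s| < L ∧ |s + t| < L := by
    rcases lt_or_gt_of_ne hne with h | h <;>
      constructor <;> rw [abs_lt] <;> constructor <;> linarith [hs.1, hs.2, ht.1, ht.2]
  rcases hfib s t hst with h | h
  · exact hne (by linarith [hsmall h hlt.1])
  · exact hne (by linarith [hsmall h hlt.2, hs.1, ht.1])

theorem exists_mem_Icc_half_period (heven : γ.Even) (hL : 0 < L) (hLγ : γ.Periodic L) (t : ℝ) :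
    ∃ s ∈ Icc 0 (L / 2), γ s = γ t := by
  obtain ⟨s, hs, hst⟩ := hLγ.exists_mem_Ico₀ hL t
  rcases le_total s (L / 2) with h | h
  · exact ⟨s, ⟨hs.1, h⟩, hst.symm⟩
  · exact ⟨L - s, ⟨by linarith [hs.2], by linarith⟩, by rw [hLγ.sub_eq', heven, hst]⟩

end Periodic

section CompactCurve

variable {M : Type*} [TopologicalSpace M] [ChartedSpace (EuclideanHalfSpace 1) M]
variable {F : Type*} [NormedAddCommGroup F] [NormedSpace ℝ F] {e : M → F} {γ : ℝ → M}

theorem exists_eq_and_ne_and_add_ne_zero [CompactSpace M] (hγ : ∀ t, IsUnitSpeedAt e γ t)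
    (hsurj : Function.Surjective γ) : ∃ a b, γ a = γ b ∧ a ≠ b ∧ a + b ≠ 0 := by
  have hopen : ∀ n : ℕ, IsOpen (γ '' Metric.ball 0 n) := fun n => isOpen_iff_mem_nhds.2 <| by
    rintro _ ⟨t, ht, rfl⟩
    exact (hγ t).image_mem_nhds (Metric.isOpen_ball.mem_nhds ht)
  have hcover : univ ⊆ ⋃ n : ℕ, γ '' Metric.ball 0 n := by
    rw [← image_iUnion, Metric.iUnion_ball_nat, image_univ, hsurj.range_eq]
  have hmono : Monotone fun n : ℕ => γ '' Metric.ball 0 n := fun m n hmn =>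
    image_mono (Metric.ball_subset_ball (Nat.cast_le.2 hmn))
  obtain ⟨n, hn⟩ := isCompact_univ.elim_directed_cover _ hopen hcover hmono.directed_le
  obtain ⟨t, ht, htn⟩ := hn (mem_univ (γ n))
  rw [Real.ball_eq_Ioo, mem_Ioo] at ht
  exact ⟨n, t, htn.symm, by linarith, by linarith⟩

theorem exists_pos_forall_periodic_iff_of_isUnitSpeedAt [CompactSpace M]
    (hγ : ∀ t, IsUnitSpeedAt e γ t) (hsurj : Function.Surjective γ)
    (hfib : ∀ a b, γ a = γ b → γ.Periodic (b - a) ∨ γ.Periodic (a + b)) :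
    ∃ L > 0, ∀ x, γ.Periodic x ↔ ∃ n : ℤ, x = n * L := by
  obtain ⟨V, hV, hinj⟩ := ((hγ 0).isUnfoldedAt_of_subset_Ici_or_Iic (.inl subset_rfl)).exists_injOn
  obtain ⟨a, b, hab, hne, hne'⟩ := exists_eq_and_ne_and_add_ne_zero hγ hsurj
  rcases hfib a b hab with h | h
  · exact exists_pos_forall_periodic_iff hV hinj h (sub_ne_zero.2 hne.symm)
  · exact exists_pos_forall_periodic_iff hV hinj h hne'

end CompactCurve

/-! ### The circle and the interval -/

theorem contMDiffAt_circle_arg_one :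
    ContMDiffAt (𝓡 1) 𝓘(ℝ) ∞ (fun z : Circle => Complex.arg z) 1 := by
  have := finrank_real_complex_fact'
  have hcoe : ContMDiffAt (𝓡 1) 𝓘(ℝ, ℂ) ∞ (fun z : Circle => (z : ℂ)) 1 :=
    contMDiff_coe_sphere (E := ℂ) (n := 1) (1 : Circle)
  have hlog : ContDiffAt ℝ ∞ Complex.log ((1 : Circle) : ℂ) :=
    (Complex.contDiffAt_log (by simp [Complex.slitPlane])).restrict_scalars ℝ
  have him : ContDiffAt ℝ ∞ (fun z => (Complex.log z).im) ((1 : Circle) : ℂ) :=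
    Complex.imCLM.contDiff.contDiffAt.comp _ hlog
  have h := ContMDiffAt.comp (1 : Circle) him.contMDiffAt hcoe
  simp only [Complex.log_im] at h
  exact h

theorem exists_contMDiffAt_circleExp_eq (θ : ℝ) :
    ∃ a : Circle → ℝ, ContMDiffAt (𝓡 1) 𝓘(ℝ) ∞ a (Circle.exp θ) ∧ ∀ z, Circle.exp (a z) = z := by
  refine ⟨fun z => θ + Complex.arg ((z * (Circle.exp θ)⁻¹ : Circle) : ℂ), ?_, fun z => ?_⟩
  · have hmul : ContMDiffAt (𝓡 1) (𝓡 1) ∞ (fun z => z * (Circle.exp θ)⁻¹) (Circle.exp θ) :=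
      contMDiffAt_id.mul contMDiffAt_const
    exact contMDiffAt_const.add (ContMDiffAt.comp_of_eq contMDiffAt_circle_arg_one hmul (by simp))
  · rw [Circle.exp_add, Circle.exp_arg, mul_comm, inv_mul_cancel_right]

theorem exists_circle_equiv_exp_eq {X : Type*} {γ : ℝ → X} {κ : ℝ} (hκ : κ ≠ 0)
    (hsurj : Function.Surjective γ)
    (hγ : ∀ a b, γ a = γ b ↔ ∃ n : ℤ, b = a + n * (κ * (2 * Real.pi))) :
    ∃ E : Circle ≃ X, ∀ θ, E (Circle.exp θ) = γ (κ * θ) := by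
  have hexp : ∀ θ θ', Circle.exp θ = Circle.exp θ' ↔ γ (κ * θ) = γ (κ * θ') := fun θ θ' => by
    rw [eq_comm, Circle.exp_eq_exp, hγ]
    refine exists_congr fun n => ?_
    rw [mul_left_comm _ κ, ← mul_add, mul_right_inj' hκ]
  have harg : ∀ θ, γ (κ * Complex.arg (Circle.exp θ)) = γ (κ * θ) := fun θ =>
    (hexp _ _).1 (Circle.exp_arg _)
  refine ⟨.ofBijective (fun z => γ (κ * Complex.arg z)) ⟨fun z w hzw => ?_, fun x => ?_⟩, harg⟩
  · rwa [← hexp, Circle.exp_arg, Circle.exp_arg] at hzw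
  · obtain ⟨t, rfl⟩ := hsurj x
    exact ⟨Circle.exp (t / κ), (harg _).trans (by rw [mul_div_cancel₀ _ hκ])⟩

theorem exists_Icc_equiv_mul_eq {X : Type*} {γ : ℝ → X} {ℓ : ℝ} (hℓ : 0 < ℓ)
    (hinj : InjOn γ (Icc 0 ℓ)) (hsurj : ∀ x, ∃ t ∈ Icc 0 ℓ, γ t = x) :
    ∃ E : Icc (0 : ℝ) 1 ≃ X, ∀ t, E t = γ (ℓ * t) := by
  have hmem : ∀ {t}, ℓ * t ∈ Icc 0 ℓ ↔ t ∈ Icc 0 1 := by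
    simp only [mem_Icc, mul_nonneg_iff_of_pos_left hℓ, mul_le_iff_le_one_right hℓ, implies_true]
  refine ⟨.ofBijective (fun t => γ (ℓ * t)) ⟨fun s t hst => ?_, fun x => ?_⟩, fun t => rfl⟩
  · exact Subtype.ext (mul_left_cancel₀ hℓ.ne' (hinj (hmem.2 s.2) (hmem.2 t.2) hst))
  · obtain ⟨t, ht, rfl⟩ := hsurj x
    rw [← mul_div_cancel₀ t hℓ.ne'] at ht ⊢
    exact ⟨⟨t / ℓ, hmem.1 ht⟩, rfl⟩

section Classification

variable {M : Type*} [TopologicalSpace M] [ChartedSpace (EuclideanHalfSpace 1) M]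

theorem nonempty_diffeomorph_circle [T2Space M] {γ : ℝ → M} {L : ℝ} (hL : 0 < L)
    (hunf : ∀ t, IsUnfoldedAt γ univ t) (hsurj : Function.Surjective γ)
    (hγ : ∀ a b, γ a = γ b ↔ ∃ n : ℤ, b = a + n * L) :
    Nonempty (M ≃ₘ⟮𝓡∂ 1, 𝓡 1⟯ Circle) := by
  obtain ⟨κ, hκ, rfl⟩ : ∃ κ, κ ≠ 0 ∧ L = κ * (2 * Real.pi) :=
    ⟨L / (2 * Real.pi), by positivity, by field_simp⟩
  obtain ⟨E, hE⟩ := exists_circle_equiv_exp_eq hκ hsurj hγ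
  have hangle : ∀ z, ∃ a : Circle → ℝ, ContMDiffAt (𝓡 1) 𝓘(ℝ) ∞ a z ∧
      (∀ w, Circle.exp (a w) = w) ∧ ∀ w, γ (κ * a w) = E w := fun z => by
    obtain ⟨θ, rfl⟩ := Circle.exp_surjective z
    obtain ⟨a, ha, hexp⟩ := exists_contMDiffAt_circleExp_eq θ
    exact ⟨a, ha, hexp, fun w => by rw [← hE, hexp]⟩
  have hsmooth : ContMDiff (𝓡 1) (𝓡∂ 1) ∞ E := fun z => by
    obtain ⟨a, ha, -, hγa⟩ := hangle z
    rw [← funext hγa]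
    have hγz := (hunf (κ * a z)).contMDiffWithinAt (mem_univ _)
    exact ContMDiffAt.comp z (contMDiffWithinAt_univ.1 hγz) (contMDiffAt_const.mul ha)
  have hsymm : Continuous E.symm :=
    (Continuous.homeoOfEquivCompactToT2 (f := E) hsmooth.continuous).symm.continuous
  refine ⟨{ toEquiv := E.symm, contMDiff_toFun := fun x => ?_, contMDiff_invFun := hsmooth }⟩
  obtain ⟨a, ha, hexp, hγa⟩ := hangle (E.symm x)
  have hτ : ContMDiffAt (𝓡∂ 1) 𝓘(ℝ) ∞ (fun y => κ * a (E.symm y)) x :=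
    (hunf _).contMDiffAt_section
      ((ContinuousAt.comp ha.continuousAt hsymm.continuousAt).const_mul κ)
      (.of_forall fun y => ⟨mem_univ _, by rw [hγa, E.apply_symm_apply]⟩)
  have hcomp := ContMDiffAt.comp x (contMDiff_circleExp _) (contMDiffAt_const (c := κ⁻¹) |>.mul hτ)
  exact hcomp.congr_of_eventuallyEq (.of_forall fun y => by simp [inv_mul_cancel_left₀ hκ, hexp])

theorem nonempty_diffeomorph_Icc [T2Space M] {γ : ℝ → M} {ℓ : ℝ} (hℓ : 0 < ℓ)
    (hunf : ∀ t ∈ Icc 0 ℓ, IsUnfoldedAt γ (Icc 0 ℓ) t) (hinj : InjOn γ (Icc 0 ℓ))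
    (hsurj : ∀ x, ∃ t ∈ Icc 0 ℓ, γ t = x) :
    Nonempty (M ≃ₘ⟮𝓡∂ 1, 𝓡∂ 1⟯ (Icc (0 : ℝ) 1)) := by
  obtain ⟨E, hE⟩ := exists_Icc_equiv_mul_eq hℓ hinj hsurj
  have hmaps : ∀ t ∈ Icc (0 : ℝ) 1, ℓ * t ∈ Icc 0 ℓ := fun t ht =>
    ⟨mul_nonneg hℓ.le ht.1, mul_le_of_le_one_right hℓ.le ht.2⟩
  have hsmooth : ContMDiff (𝓡∂ 1) (𝓡∂ 1) ∞ E := by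
    rw [← contMDiffOn_comp_projIcc_iff]
    have hγ : ContMDiffOn 𝓘(ℝ) (𝓡∂ 1) ∞ γ (Icc 0 ℓ) := fun t ht => (hunf t ht).contMDiffWithinAt ht
    have hmul : ContMDiff 𝓘(ℝ) 𝓘(ℝ) ∞ fun t : ℝ => ℓ * t :=
      (contDiff_const.mul contDiff_id).contMDiff
    refine (hγ.comp hmul.contMDiffOn hmaps).congr fun t ht => ?_
    simp only [Function.comp_apply, hE, projIcc_of_mem _ ht]
  have hsymm : Continuous E.symm :=
    (Continuous.homeoOfEquivCompactToT2 (f := E) hsmooth.continuous).symm.continuous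
  refine ⟨{ toEquiv := E.symm, contMDiff_toFun := ?_, contMDiff_invFun := hsmooth }⟩
  refine contMDiff_iff_comp_subtypeVal_Icc.2 ⟨hsymm, fun x => ?_⟩
  have hτ : ContMDiffAt (𝓡∂ 1) 𝓘(ℝ) ∞ (fun y => ℓ * (E.symm y : ℝ)) x :=
    (hunf _ (hmaps _ (E.symm x).2)).contMDiffAt_section
      ((continuous_subtype_val.comp hsymm).const_mul ℓ).continuousAt
      (.of_forall fun y => ⟨hmaps _ (E.symm y).2, by rw [← hE, E.apply_symm_apply]⟩)
  exact (contMDiffAt_const (c := ℓ⁻¹) |>.mul hτ).congr_of_eventuallyEq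
    (.of_forall fun y => (inv_mul_cancel_left₀ hℓ.ne' _).symm)

section

variable {F : Type*} [NormedAddCommGroup F] [NormedSpace ℝ F] {e : M → F} {γ : ℝ → M}

theorem isUnfoldedAt_univ_of_forall_reflection_ne [T2Space M] (hγ : ∀ t, IsUnitSpeedAt e γ t)
    (hrefl : ∀ c, ¬ ∀ t, γ (2 * c - t) = γ t) (t : ℝ) : IsUnfoldedAt γ univ t := by
  refine (hγ t).isUnfoldedAt_univ_or_comp_eventuallyEq.resolve_right fun heven => hrefl t ?_
  have h : EqOn (γ ∘ IsometryEquiv.subLeft (2 * t)) γ univ :=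
    eqOn_of_isUnitSpeedAt isPreconnected_univ (fun _ _ => (hγ _).comp_isometryEquiv)
      (fun s _ => hγ s) (mem_univ t) (heven (.subLeft (2 * t)) (by simp [two_mul]))
  exact fun s => h (mem_univ s)

theorem nonempty_diffeomorph_circle_of_forall_reflection_ne [T2Space M] [CompactSpace M]
    (hγ : ∀ t, IsUnitSpeedAt e γ t) (hsurj : Function.Surjective γ)
    (hrefl : ∀ c, ¬ ∀ t, γ (2 * c - t) = γ t) : Nonempty (M ≃ₘ⟮𝓡∂ 1, 𝓡 1⟯ Circle) := by
  have hfib : ∀ a b, γ a = γ b → γ.Periodic (b - a) := fun a b hab => by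
    obtain ⟨φ, rfl, hφ⟩ := exists_isometryEquiv_comp_eq_of_eq hγ hab
    rcases realIsometryEquiv_eq_add_or_sub φ with h | h
    · intro t
      rw [← congrFun hφ t, Function.comp_apply, h a, h t]
      ring_nf
    · refine absurd (fun t => ?_) (hrefl (φ 0 / 2))
      rw [← congrFun hφ t, Function.comp_apply, h t]
      ring_nf
  obtain ⟨L, hL, hperiod⟩ := exists_pos_forall_periodic_iff_of_isUnitSpeedAt hγ hsurj
    fun a b hab => .inl (hfib a b hab)
  refine nonempty_diffeomorph_circle hL (isUnfoldedAt_univ_of_forall_reflection_ne hγ hrefl) hsurj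
    fun a b => ⟨fun hab => ?_, ?_⟩
  · obtain ⟨n, hn⟩ := (hperiod _).1 (hfib a b hab)
    exact ⟨n, by linarith⟩
  · rintro ⟨n, rfl⟩
    exact ((hperiod _).2 ⟨n, rfl⟩ a).symm

theorem nonempty_diffeomorph_Icc_of_even [T2Space M] [CompactSpace M]
    (hγ : ∀ t, IsUnitSpeedAt e γ t) (hsurj : Function.Surjective γ) (heven : γ.Even) :
    Nonempty (M ≃ₘ⟮𝓡∂ 1, 𝓡∂ 1⟯ (Icc (0 : ℝ) 1)) := by
  have hfib : ∀ a b, γ a = γ b → γ.Periodic (b - a) ∨ γ.Periodic (a + b) := fun a b hab => by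
    obtain ⟨φ, rfl, hφ⟩ := exists_isometryEquiv_comp_eq_of_eq hγ hab
    rcases realIsometryEquiv_eq_add_or_sub φ with h | h
    · refine .inl fun t => ?_
      rw [← congrFun hφ t, Function.comp_apply, h a, h t]
      ring_nf
    · refine .inr fun t => ?_
      rw [← heven t, ← congrFun hφ (-t), Function.comp_apply, h a, h (-t)]
      ring_nf
  obtain ⟨L, hL, hperiod⟩ := exists_pos_forall_periodic_iff_of_isUnitSpeedAt hγ hsurj hfib
  have hinj := injOn_Icc_half_period hperiod hfib
  refine nonempty_diffeomorph_Icc (half_pos hL)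
    (fun t _ => (hγ t).isUnfoldedAt_of_injOn ordConnected_Icc hinj) hinj fun x => ?_
  obtain ⟨t, rfl⟩ := hsurj x
  exact exists_mem_Icc_half_period heven hL ((hperiod L).2 ⟨1, by simp⟩) t

end

theorem nonempty_diffeomorph_circle_or_Icc [IsManifold (𝓡∂ 1) ∞ M] [T2Space M] [CompactSpace M]
    [ConnectedSpace M] : Nonempty (M ≃ₘ⟮𝓡∂ 1, 𝓡 1⟯ Circle) ∨
      Nonempty (M ≃ₘ⟮𝓡∂ 1, 𝓡∂ 1⟯ (Icc (0 : ℝ) 1)) := by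
  obtain ⟨n, e, he, -, hinj⟩ := exists_embedding_euclidean_of_compact (I := 𝓡∂ 1) (M := M)
  obtain ⟨ε, hε, hloc⟩ := exists_pos_forall_exists_isUnitSpeedAt (exists_unitSpeedChart he hinj)
  obtain ⟨γ, hγ⟩ := exists_forall_isUnitSpeedAt hε hloc
  by_cases hrefl : ∃ c, ∀ t, γ (2 * c - t) = γ t
  · obtain ⟨c, hc⟩ := hrefl
    have hδ : ∀ t, IsUnitSpeedAt e (γ ∘ IsometryEquiv.addLeft c) t := fun t =>
      (hγ _).comp_isometryEquiv
    refine .inr (nonempty_diffeomorph_Icc_of_even hδ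
      (surjective_of_forall_isUnitSpeedAt hε hloc hδ) fun t => ?_)
    rw [Function.comp_apply, IsometryEquiv.addLeft_apply, ← hc]
    simp only [Function.comp_apply, IsometryEquiv.addLeft_apply]
    ring_nf
  · exact .inl (nonempty_diffeomorph_circle_of_forall_reflection_ne hγ
      (surjective_of_forall_isUnitSpeedAt hε hloc hγ) (not_exists.1 hrefl))

end Classification

/-! ### Boundary points and cobordism -/

theorem finite_and_even_ncard_of_forall_inter_fiber {X ι : Type*} [Finite ι] {B : Set X}
    (f : X → ι) (hB : ∀ i, (B ∩ f ⁻¹' {i}).Finite ∧ Even (B ∩ f ⁻¹' {i}).ncard) :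
    B.Finite ∧ Even B.ncard := by
  have hunion : B = ⋃ i, B ∩ f ⁻¹' {i} := by
    rw [← inter_iUnion, ← preimage_iUnion, iUnion_of_singleton, preimage_univ, inter_univ]
  have hdisj : Pairwise (Function.onFun Disjoint fun i => B ∩ f ⁻¹' {i}) := fun i j hij =>
    ((disjoint_singleton.2 hij).preimage f).mono inter_subset_right inter_subset_right
  rw [hunion, ncard_iUnion_of_finite (fun i => (hB i).1) hdisj]
  exact ⟨finite_iUnion fun i => (hB i).1,
    finsum_induction _ Even.zero (fun _ _ => Even.add) fun i => (hB i).2⟩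

theorem finite_and_even_ncard_of_forall_inter_connectedComponent {X : Type*} [TopologicalSpace X]
    [CompactSpace X] [LocallyConnectedSpace X] {B : Set X}
    (hB : ∀ x, (B ∩ connectedComponent x).Finite ∧ Even (B ∩ connectedComponent x).ncard) :
    B.Finite ∧ Even B.ncard := by
  refine finite_and_even_ncard_of_forall_inter_fiber (ι := ConnectedComponents X) (↑) fun c => ?_
  obtain ⟨x, rfl⟩ := ConnectedComponents.surjective_coe c
  rw [connectedComponents_preimage_singleton]
  exact hB x

section Boundary

variable {M : Type*} [TopologicalSpace M] [ChartedSpace (EuclideanHalfSpace 1) M]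

theorem extChartAt_self_eq_zero_of_mem_boundary {x : M} (hx : x ∈ (𝓡∂ 1).boundary M) :
    extChartAt (𝓡∂ 1) x x = 0 := by
  rw [ModelWithCorners.boundary, mem_ofPred_eq, ModelWithCorners.isBoundaryPoint_iff,
    frontier_range_modelWithCornersEuclideanHalfSpace] at hx
  ext i
  rw [Subsingleton.elim i 0]
  exact Eq.symm hx

variable [IsManifold (𝓡∂ 1) ∞ M] [T2Space M]

theorem finite_boundary_and_even_ncard_of_connectedSpace [CompactSpace M] [ConnectedSpace M] :
    ((𝓡∂ 1).boundary M).Finite ∧ Even ((𝓡∂ 1).boundary M).ncard := by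
  rcases nonempty_diffeomorph_circle_or_Icc (M := M) with ⟨⟨Φ⟩⟩ | ⟨⟨Φ⟩⟩
  · have : IsManifold (𝓡 1) ∞ Circle := IsManifold.of_le (n := ω) le_top
    rw [← Φ.preimage_boundary (by simp), ModelWithCorners.Boundaryless.boundary_eq_empty]
    simp
  · have himage : (𝓡∂ 1).boundary M = Φ.symm '' {⊥, ⊤} := by
      rw [← boundary_Icc (x := (0 : ℝ)) (y := 1), Φ.symm.image_boundary (by simp)]
    have hinj : Function.Injective (Φ.symm : Icc (0 : ℝ) 1 → M) := Φ.symm.injective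
    rw [himage, ncard_image_of_injective _ hinj, ncard_pair (by simp)]
    exact ⟨(toFinite _).image _, even_two⟩

theorem finite_boundary_and_even_ncard [CompactSpace M] :
    ((𝓡∂ 1).boundary M).Finite ∧ Even ((𝓡∂ 1).boundary M).ncard := by
  have : LocallyConnectedSpace M := ChartedSpace.locallyConnectedSpace (EuclideanHalfSpace 1) M
  refine finite_and_even_ncard_of_forall_inter_connectedComponent fun x => ?_
  let V : TopologicalSpace.Opens M := ⟨connectedComponent x, isOpen_connectedComponent⟩
  have : ConnectedSpace V := isConnected_iff_connectedSpace.1 isConnected_connectedComponent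
  have : CompactSpace V := isCompact_iff_compactSpace.1 isClosed_connectedComponent.isCompact
  have hV := finite_boundary_and_even_ncard_of_connectedSpace (M := V)
  rw [ModelWithCorners.boundary_open] at hV
  have himage : (𝓡∂ 1).boundary M ∩ connectedComponent x =
      (Subtype.val : V → M) '' (Subtype.val ⁻¹' (𝓡∂ 1).boundary M) := by
    rw [inter_comm]
    exact (Subtype.image_preimage_coe _ _).symm
  rw [himage, ncard_image_of_injective _ Subtype.val_injective]
  exact ⟨hV.1.image _, hV.2⟩

theorem exists_finite_boundary_and_ncard_eq_add_self (k : ℕ) :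
    ∃ (M : Type u) (_ : TopologicalSpace M) (_ : T2Space M) (_ : CompactSpace M)
      (_ : ChartedSpace (EuclideanHalfSpace 1) M) (_ : IsManifold (𝓡∂ 1) ∞ M),
      ((𝓡∂ 1).boundary M).Finite ∧ ((𝓡∂ 1).boundary M).ncard = k + k := by
  induction k with
  | zero =>
    let _ : ChartedSpace (EuclideanHalfSpace 1) PEmpty.{u + 1} := ChartedSpace.empty _ _
    refine ⟨PEmpty.{u + 1}, inferInstance, inferInstance, inferInstance, inferInstance,
      inferInstance, toFinite _, ?_⟩
    rw [Set.eq_empty_of_isEmpty ((𝓡∂ 1).boundary PEmpty.{u + 1}), ncard_empty]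
  | succ k ih =>
    obtain ⟨M, _, _, _, _, _, hfin, hcard⟩ := ih
    refine ⟨M ⊕ Icc (0 : ℝ) 1, inferInstance, inferInstance, inferInstance, inferInstance,
      inferInstance, ?_⟩
    have hends : ({⊥, ⊤} : Set (Icc (0 : ℝ) 1)).Finite := toFinite _
    rw [ModelWithCorners.boundary_disjointUnion, boundary_Icc]
    refine ⟨(hfin.image _).union (hends.image _), ?_⟩
    rw [ncard_union_eq disjoint_image_inl_image_inr (hfin.image _) (hends.image _),
      ncard_image_of_injective _ Sum.inl_injective, ncard_image_of_injective _ Sum.inr_injective,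
      hcard, ncard_pair (by simp)]
    ring

theorem isSmoothEmbedding_of_injective_of_mem_boundary {X : Type*} [TopologicalSpace X]
    [ChartedSpace (EuclideanSpace ℝ (Fin 0)) X] [IsManifold (𝓡 0) ∞ X] [CompactSpace X]
    {f : X → M} (hf : Function.Injective f) (hmem : ∀ x, f x ∈ (𝓡∂ 1).boundary M) :
    Manifold.IsSmoothEmbedding (𝓡 0) (𝓡∂ 1) ∞ f := by
  have : DiscreteTopology X := ChartedSpace.discreteTopology (EuclideanSpace ℝ (Fin 0)) X
  have hcont : Continuous f := continuous_of_discreteTopology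
  refine ⟨Manifold.IsImmersionOfComplement.isImmersion (F := EuclideanSpace ℝ (Fin 1)) fun x => ?_,
    (hcont.isClosedEmbedding hf).isEmbedding⟩
  refine Manifold.IsImmersionAtOfComplement.mk_of_continuousAt hcont.continuousAt
    (ContinuousLinearEquiv.uniqueProd ℝ (EuclideanSpace ℝ (Fin 1)) (EuclideanSpace ℝ (Fin 0)))
    (chartAt _ x) (chartAt _ (f x)) (mem_chart_source _ x) (mem_chart_source _ (f x))
    (IsManifold.chart_mem_maximalAtlas x) (IsManifold.chart_mem_maximalAtlas (f x)) fun z _ => ?_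
  have hz : ((chartAt (EuclideanSpace ℝ (Fin 0)) x).extend (𝓡 0)).symm z = x := by
    rw [Subsingleton.elim z (extChartAt (𝓡 0) x x)]
    exact extChartAt_to_inv x
  simp only [Function.comp_apply, hz]
  rw [Subsingleton.elim z 0]
  exact (extChartAt_self_eq_zero_of_mem_boundary (hmem x)).trans (map_zero _).symm

end Boundary

namespace ClosedManifold

variable {M N : ClosedManifold.{u} 0}

theorem finite_carrier (M : ClosedManifold.{u} 0) : Finite M.carrier := by
  have : DiscreteTopology M.carrier := ChartedSpace.discreteTopology (EuclideanSpace ℝ (Fin 0)) _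
  exact finite_of_compact_of_discrete

theorem card_empty : Nat.card (empty.{u} 0).carrier = 0 :=
  Nat.card_eq_zero.2 (.inl (inferInstanceAs (IsEmpty PEmpty)))

theorem card_point : Nat.card point.{u}.carrier = 1 :=
  Nat.card_unique (α := PUnit)

theorem Cobordant.even_card_add_card (h : M.Cobordant N) :
    Even (Nat.card M.carrier + Nat.card N.carrier) := by
  have := M.finite_carrier
  have := N.finite_carrier
  obtain ⟨W, _, _, _, _, _, f, hf, hrange⟩ := h
  rw [← Nat.card_sum, ← ncard_univ, ← ncard_image_of_injective _ hf.isEmbedding.injective,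
    image_univ, hrange]
  exact finite_boundary_and_even_ncard.2

theorem cobordant_of_even_card_add_card (h : Even (Nat.card M.carrier + Nat.card N.carrier)) :
    M.Cobordant N := by
  have := M.finite_carrier
  have := N.finite_carrier
  obtain ⟨k, hk⟩ := h
  obtain ⟨W, _, _, _, _, _, hfin, hcard⟩ := exists_finite_boundary_and_ncard_eq_add_self.{u} k
  have := hfin.to_subtype
  obtain ⟨E⟩ : Nonempty (M.carrier ⊕ N.carrier ≃ (𝓡∂ 1).boundary W) := by
    rw [← Finite.card_eq, Nat.card_sum, hk, Nat.card_coe_set_eq, hcard]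
  refine ⟨W, inferInstance, inferInstance, inferInstance, inferInstance, inferInstance,
    Subtype.val ∘ E, ?_, ?_⟩
  · exact isSmoothEmbedding_of_injective_of_mem_boundary
      (Subtype.val_injective.comp E.injective) fun x => (E x).2
  · rw [range_comp, E.surjective.range_eq, image_univ, Subtype.range_coe]

theorem cobordant_iff_even_card_iff :
    M.Cobordant N ↔ (Even (Nat.card M.carrier) ↔ Even (Nat.card N.carrier)) := by
  rw [← Nat.even_add]
  exact ⟨Cobordant.even_card_add_card, cobordant_of_even_card_add_card⟩

theorem cobordant_empty_iff : M.Cobordant (empty 0) ↔ Even (Nat.card M.carrier) := by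
  rw [cobordant_iff_even_card_iff, card_empty, iff_true_right Even.zero]

theorem cobordant_point_iff : M.Cobordant point ↔ Odd (Nat.card M.carrier) := by
  rw [cobordant_iff_even_card_iff, card_point, iff_false_right Nat.not_even_one,
    Nat.not_even_iff_odd]

theorem equivalence_cobordant :
    Equivalence (Cobordant : ClosedManifold.{u} 0 → ClosedManifold.{u} 0 → Prop) where
  refl _ := cobordant_iff_even_card_iff.2 Iff.rfl
  symm := by
    simp only [cobordant_iff_even_card_iff]
    exact Iff.symm
  trans := by
    simp only [cobordant_iff_even_card_iff]
    exact Iff.trans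

theorem card_cobordismClass_zero : Nat.card (CobordismClass.{u} 0) = 2 := by
  refine Nat.card_eq_two_iff.2 ⟨Quot.mk _ (empty 0), Quot.mk _ point, fun h => ?_, ?_⟩
  · have hcob := equivalence_cobordant.eqvGen_iff.1 (Quot.eqvGen_exact h)
    rw [cobordant_point_iff, card_empty] at hcob
    exact Nat.not_odd_zero hcob
  · refine eq_univ_of_forall fun c => ?_
    induction c using Quot.ind with | _ M
    exact (Nat.even_or_odd (Nat.card M.carrier)).imp
      (fun h => Quot.sound (cobordant_empty_iff.2 h)) fun h => Quot.sound (cobordant_point_iff.2 h)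

end ClosedManifold

end

theorem theorem1 :
    -- a compact one-dimensional manifold with boundary has an even number of boundary points
    (∀ (M : Type u) [TopologicalSpace M] [T2Space M] [CompactSpace M]
        [ChartedSpace (EuclideanHalfSpace 1) M] [IsManifold (𝓡∂ 1) ∞ M],
      ((𝓡∂ 1).boundary M).Finite ∧ Even ((𝓡∂ 1).boundary M).ncard) ∧
    -- if it is connected, it is a circle or a compact interval
    (∀ (M : Type u) [TopologicalSpace M] [T2Space M] [CompactSpace M] [ConnectedSpace M]
        [ChartedSpace (EuclideanHalfSpace 1) M] [IsManifold (𝓡∂ 1) ∞ M],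
      Nonempty (M ≃ₘ⟮𝓡∂ 1, 𝓡 1⟯ Circle) ∨
        Nonempty (M ≃ₘ⟮𝓡∂ 1, 𝓡∂ 1⟯ (Set.Icc (0 : ℝ) 1))) ∧
    -- `m` points are the boundary of such a manifold if and only if `m` is even
    (∀ m : ℕ,
      (∃ (M : Type u) (_ : TopologicalSpace M) (_ : T2Space M) (_ : CompactSpace M)
          (_ : ChartedSpace (EuclideanHalfSpace 1) M) (_ : IsManifold (𝓡∂ 1) ∞ M),
        ((𝓡∂ 1).boundary M).Finite ∧ ((𝓡∂ 1).boundary M).ncard = m) ↔ Even m) ∧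
    -- a closed 0-manifold is finite, and it is cobordant to the empty manifold or to a point
    -- according to the parity of its number of points
    (∀ M : ClosedManifold.{u} 0, Finite M.carrier ∧
      (M.Cobordant (ClosedManifold.empty 0) ↔ Even (Nat.card M.carrier)) ∧
      (M.Cobordant ClosedManifold.point ↔ Odd (Nat.card M.carrier))) ∧
    -- cobordism of closed 0-manifolds is an equivalence relation with exactly two classes,
    -- distinguished by the parity of the number of points
    Equivalence (ClosedManifold.Cobordant (n := 0) :
      ClosedManifold.{u} 0 → ClosedManifold.{u} 0 → Prop) ∧
    (∀ M N : ClosedManifold.{u} 0, M.Cobordant N ↔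
      (Even (Nat.card M.carrier) ↔ Even (Nat.card N.carrier))) ∧
    Nat.card (ClosedManifold.CobordismClass.{u} 0) = 2 := by
  refine ⟨fun M => by intros; exact finite_boundary_and_even_ncard,
    fun M => by intros; exact nonempty_diffeomorph_circle_or_Icc, fun m => ⟨?_, ?_⟩,
    fun M => ⟨M.finite_carrier, ClosedManifold.cobordant_empty_iff,
      ClosedManifold.cobordant_point_iff⟩,
    ClosedManifold.equivalence_cobordant, fun M N => ClosedManifold.cobordant_iff_even_card_iff,
    ClosedManifold.card_cobordismClass_zero⟩
  · rintro ⟨M, _, _, _, _, _, -, rfl⟩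
    exact finite_boundary_and_even_ncard.2
  · rintro ⟨k, rfl⟩
    exact exists_finite_boundary_and_ncard_eq_add_self k
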